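/- Setting. Let $P_1,\dots,P_m\subset\mathbb R^2$ be non-empty compact sets, each the closure of its interior (prototiles). A tile is a placed copy $T=R_\alpha P_i+t$, where $R_\alpha$ is the rotation through $\alpha\in[0,2\pi)$ and $t\in\mathbb R^2$; the type $i$ and the placement $(\alpha,t)$ belong to the tile, $\phi(T)=\alpha$ is its orientation, and two patches are congruent if a direct Euclidean motion maps one to the other, respecting types and placements. A self-similar substitution with factor $\lambda>1$ is a map $\sigma$ assigning to each $P_i$ a finite collection $\sigma(P_i)$ of tiles with pairwise disjoint interiors such that $\lambda P_i=\bigcup_{T\in\sigma(P_i)}T$; it is extended by $\sigma(RP_i+t)=R\sigma(P_i)+\lambda t$ and $\sigma(\mathcal F)=\bigcup_{T\in\mathcal F}\sigma(T)$. The patches $\sigma^k(P_i)$ are the supertiles of order $k$. It is primitive if some power $M^k$, $k\ge1$, of the matrix $M_{ij}=\#\{T\in\sigma(P_j): T \text{ is a copy of } P_i\}$ is strictly positive. A substitution tiling is a collection $\mathcal T$ of tiles with pairwise disjoint interiors that covers $\mathbb R^2$ and each of whose finite subsets is congruent to a subset of some supertile. A numbering $\mathcal T=\{T_1,T_2,\dots\}$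 (without repetitions) is supertile-compatible if for every $n\ge1$ there is $\ell\ge n$ such that $\{T_1,\dots,T_\ell\}$ is congruent to a supertile of order at least $1$; such an $\ell$ is called a supertile length of the numbering. A sequence $(a_j)_{j\ge1}$ in $[0,2\pi)$ is equidistributed if for all $0\le x<y<2\pi$ $$\lim_{n\to\infty}\frac1n\sum_{j=1}^n 1_{[x,y]}(a_j)=\frac{y-x}{2\pi},$$ and equidistributed along an infinite set $N\subseteq\mathbb N$ if this holds for $n\to\infty$ with $n\in N$. Theorem. Let $\mathcal T$ be a substitution tiling of the plane for a primitive self-similar substitution, and suppose that copies of some prototile occur in $\mathcal T$ in infinitely many orientations. Then $\mathcal T$ has statistical circular symmetry, in the following sense. (1) For every supertile-compatible numbering of $\mathcal T$, the sequence $(\phi(T_j))_{j\ge1}$ is equidistributed along the set of supertile lengths of the numbering. (2) If $\mathcal T$ has a supertile-compatible numbering, then it has one for which the whole sequence $(\phi(T_j))_{j\ge1}$ is equidistributed in $[0,2\pi)$. (3) For every $p\in\mathbb R^2$ and every numbering of $\mathcal T$ by non-decreasing distance of the tiles to $p$, the whole sequence $(\phi(T_j))_{j\ge1}$ is equidistributed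 in $[0,2\pi)$. -/

import Mathlib

open Filter Topology

noncomputable section

/-- A placed copy `R P_i + t` of the prototile with index `i`: `idx = i`, the rotation `R` is
multiplication by the unit complex number `rot`, and `trans = t`. The plane is `ℂ`.
The placement is kept as data (a decoration), so the orientation of a tile is well defined even if
the set `P_i` has rotational symmetries or if two prototiles are congruent as sets. -/
@[ext]
structure Tile (m : ℕ) where
  idx : Fin m
  rot : Circle
  trans : ℂ

namespace Tile

variable {m : ℕ}

/-- The image of a tile under the direct Euclidean motion `z ↦ R z + t`. -/
def move (R : Circle) (t : ℂ) (T : Tile m) : Tile m :=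
  ⟨T.idx, R * T.rot, (R : ℂ) * T.trans + t⟩

/-- The subset of the plane occupied by a tile, for the prototiles `P`. -/
def carrier (P : Fin m → Set ℂ) (T : Tile m) : Set ℂ :=
  (fun z : ℂ => (T.rot : ℂ) * z + T.trans) '' P T.idx

/-- The orientation of a tile: the angle `α ∈ [0, 2π)` of its rotation. -/
def orientation (T : Tile m) : ℝ :=
  toIcoMod Real.two_pi_pos 0 (Complex.arg (T.rot : ℂ))

end Tile

/-- No point of the plane lies in the interior of two different tiles of the collection. -/
def NonOverlapping {m : ℕ} (P : Fin m → Set ℂ) (F : Set (Tile m)) : Prop :=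
  F.PairwiseDisjoint (fun T => interior (T.carrier P))

/-- A self-similar substitution in the plane with prototiles `P_1, …, P_m` and real inflation
factor `λ > 1`. -/
structure TileSubstitution (m : ℕ) where
  proto : Fin m → Set ℂ
  proto_nonempty : ∀ i, (proto i).Nonempty
  proto_compact : ∀ i, IsCompact (proto i)
  proto_regular : ∀ i, closure (interior (proto i)) = proto i
  scale : ℝ
  one_lt_scale : 1 < scale
  /-- The tiles of `σ(P_i)`. -/
  subst : Fin m → Finset (Tile m)
  subst_nonOverlapping : ∀ i, NonOverlapping proto (subst i : Set (Tile m))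
  /-- `λ P_i = ⋃_{T ∈ σ(P_i)} T`. -/
  selfSimilar : ∀ i,
    (fun z : ℂ => (scale : ℂ) * z) '' proto i = ⋃ T ∈ subst i, T.carrier proto

namespace TileSubstitution

variable {m : ℕ} (S : TileSubstitution m)

/-- `σ(R P_i + t) = R σ(P_i) + λ t`. -/
def substTile (T : Tile m) : Set (Tile m) :=
  Tile.move T.rot ((S.scale : ℂ) * T.trans) '' (S.subst T.idx : Set (Tile m))

/-- `σ(F) = ⋃_{T ∈ F} σ(T)`. -/
def substSet (F : Set (Tile m)) : Set (Tile m) :=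
  ⋃ T ∈ F, S.substTile T

/-- The supertile `σ^k(P_i)` of order `k`. -/
def supertile (k : ℕ) (i : Fin m) : Set (Tile m) :=
  S.substSet^[k] {⟨i, 1, 0⟩}

/-- The substitution matrix: entry `(i, j)` counts the copies of `P_i` in `σ(P_j)`. -/
def substMatrix : Matrix (Fin m) (Fin m) ℕ :=
  Matrix.of fun i j => ((S.subst j).filter (fun T => T.idx = i)).card

/-- Some power of the substitution matrix is strictly positive. -/
def IsPrimitive : Prop :=
  ∃ k : ℕ, 1 ≤ k ∧ ∀ i j, 0 < (S.substMatrix ^ k) i j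

/-- A collection of tiles that covers the plane without overlaps. -/
def IsTiling (X : Set (Tile m)) : Prop :=
  (⋃ T ∈ X, T.carrier S.proto) = Set.univ ∧ NonOverlapping S.proto X

/-- A tiling each of whose finite patches has a copy inside some supertile. -/
def IsSubstitutionTiling (X : Set (Tile m)) : Prop :=
  S.IsTiling X ∧
    ∀ F : Set (Tile m), F ⊆ X → F.Finite →
      ∃ (i : Fin m) (k : ℕ) (R : Circle) (t : ℂ), Tile.move R t '' F ⊆ S.supertile k i

/-- The first `l` tiles `e 0, …, e (l - 1)` form a patch congruent to a supertile `σ^k(P_i)`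
with `k ≥ 1`. -/
def IsSupertilePrefix (e : ℕ → Tile m) (l : ℕ) : Prop :=
  ∃ (k : ℕ) (i : Fin m) (R : Circle) (t : ℂ),
    1 ≤ k ∧ e '' Set.Iio l = Tile.move R t '' S.supertile k i

/-- Arbitrarily long initial segments of the numbering are congruent to supertiles. -/
def IsSupertileCompatible (e : ℕ → Tile m) : Prop :=
  ∀ n : ℕ, ∃ l : ℕ, n ≤ l ∧ S.IsSupertilePrefix e l

/-- The tiles are numbered by non-decreasing distance to the point `p`. -/
def IsOrderedByDistance (p : ℂ) (e : ℕ → Tile m) : Prop :=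
  Monotone fun j => Metric.infDist p ((e j).carrier S.proto)

end TileSubstitution

/-- `e` lists every tile of `X` exactly once. -/
def Enumerates {m : ℕ} (e : ℕ → Tile m) (X : Set (Tile m)) : Prop :=
  Function.Injective e ∧ Set.range e = X

/-- The averages over the first `n` terms of `a` tend to the uniform distribution on `[0, 2π)`
as `n` runs along the filter `L`. -/
def EquidistributedAlong (L : Filter ℕ) (a : ℕ → ℝ) : Prop :=
  ∀ x y : ℝ, 0 ≤ x → x < y → y < 2 * Real.pi →
    Tendsto (fun n : ℕ =>
        (1 / (n : ℝ)) * ∑ j ∈ Finset.range n, (Set.Icc x y).indicator (fun _ => (1 : ℝ)) (a j))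
      L (𝓝 ((y - x) / (2 * Real.pi)))

/-- Equidistribution of a sequence in `[0, 2π)`. -/
def Equidistributed (a : ℕ → ℝ) : Prop :=
  EquidistributedAlong atTop a

end

/-! By Weyl's criterion it suffices that, for every `n ≥ 1`, the averages of the `n`-th powers of
the rotations tend to zero. For supertiles these sums are governed by matrices `weylMatrix n k`,
indexed by pairs of tile types, which multiply when orders are added (`weylMatrix_add`) and are
dominated entrywise by the tile counts, the powers of the substitution matrix.

If domination were an equality at every entry and every order, all tiles of one type in a supertile
would share the same `n`-th power of their rotation. As any two tiles of the tiling have a common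
copy in a supertile, each type would occur in only finitely many orientations. So some entry is
strictly smaller; primitivity spreads this to all entries of one order `K`, with ratios at most some
`δ < 1`, and multiplicativity gives geometric decay. Hence the Weyl sum of an order-`k` supertile is
at most `ε k` times its number of tiles, with `ε k → 0` (`exists_tendsto_norm_sum_patch_le`).

(1) Long supertile prefixes have high order, so the estimate applies directly.

(2) Between sparse supertile lengths the tiles are rearranged so that each initial part of a block
has nearly the rotation statistics of the whole block (`exists_perm_weyl_sums`). The prefixes at
these lengths are unchanged as sets.

(3) The first `N` tiles form a disc-like patch of some radius `r`. The tiling itself need not split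
into supertiles, but the patch lies in a copy of a supertile, which does split into order-`k`
supertiles. Those cut by the patch boundary meet it only in an annulus of bounded width, that is in
`O(r)` tiles, while `N` grows at least like `r²` (`exists_norm_sum_le_of_ball`). -/

noncomputable section

/-! ### Weyl's criterion on the circle, along a filter. -/

open MeasureTheory in
/-- The uniform probability measure on the first `N` terms of a sequence. -/
theorem exists_empirical_measure {α : Type*} [MeasurableSpace α] [MeasurableSingletonClass α]
    (a : ℕ → α) {N : ℕ} (hN : N ≠ 0) :
    ∃ μ : ProbabilityMeasure α,
      (∀ f : α → ℂ, ∫ x, f x ∂(μ : Measure α) = (1 / (N : ℂ)) * ∑ j ∈ Finset.range N, f (a j)) ∧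
      ∀ s : Set α, MeasurableSet s → (μ : Measure α).real s =
        (1 / (N : ℝ)) * ∑ j ∈ Finset.range N, s.indicator (fun _ => (1 : ℝ)) (a j) := by
  let ν : Measure α := (N : ENNReal)⁻¹ • ∑ j ∈ Finset.range N, Measure.dirac (a j)
  have hν : IsProbabilityMeasure ν := ⟨by
    simp [ν, ENNReal.inv_mul_cancel (Nat.cast_ne_zero.2 hN) (ENNReal.natCast_ne_top N)]⟩
  refine ⟨⟨ν, hν⟩, fun f => ?_, fun s hs => ?_⟩
  · change ∫ x, f x ∂ν = _
    simp only [ν]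
    rw [integral_smul_measure, integral_finsetSum_measure]
    · simp
    · intro j _
      exact integrable_dirac (by simp)
  · change ν.real s = _
    simp only [ν, Measure.real, Measure.smul_apply, Measure.finsetSum_apply, smul_eq_mul,
      ENNReal.toReal_mul, ENNReal.toReal_inv, ENNReal.toReal_natCast, one_div]
    congr 1
    rw [ENNReal.toReal_sum]
    · refine Finset.sum_congr rfl fun j _ => ?_
      rw [Measure.dirac_apply' _ hs]
      by_cases h : a j ∈ s <;> simp [h]
    · intro j _
      exact measure_ne_top _ _

instance fact_two_pi_pos : Fact (0 < 2 * Real.pi) := ⟨Real.two_pi_pos⟩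

open MeasureTheory in
/-- If all nontrivial Weyl sums of a sequence on the circle are asymptotically negligible, then the
averages of every continuous function converge to its mean. -/
theorem tendsto_average_of_weyl_sums {L : Filter ℕ} (hL : L ≤ atTop)
    (a : ℕ → AddCircle (2 * Real.pi))
    (h : ∀ n : ℕ, 0 < n → Tendsto (fun N : ℕ =>
      (1 / (N : ℂ)) * ∑ j ∈ Finset.range N, fourier (n : ℤ) (a j)) L (𝓝 0))
    (f : C(AddCircle (2 * Real.pi), ℂ)) :
    Tendsto (fun N : ℕ => (1 / (N : ℂ)) * ∑ j ∈ Finset.range N, f (a j)) L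
      (𝓝 (∫ x, f x ∂AddCircle.haarAddCircle)) := by
  have hZ : ∀ n : ℤ, Tendsto (fun N : ℕ =>
      (1 / (N : ℂ)) * ∑ j ∈ Finset.range N, fourier n (a j)) L
        (𝓝 (∫ x, fourier n x ∂(AddCircle.haarAddCircle (T := 2 * Real.pi)))) := by
    intro n
    have hint : ∫ x, fourier n x ∂(AddCircle.haarAddCircle (T := 2 * Real.pi))
        = if n = 0 then 1 else 0 := by
      have := congrFun (fourierCoeff_fourier (T := 2 * Real.pi) n) 0
      rw [fourierCoeff] at this
      simpa [Pi.single_apply, eq_comm] using this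
    rw [hint]
    rcases lt_trichotomy n 0 with hn | hn | hn
    · rw [if_neg hn.ne]
      obtain ⟨k, rfl⟩ : ∃ k : ℕ, n = -(k : ℤ) := ⟨n.natAbs, by omega⟩
      have := (Complex.continuous_conj.tendsto _).comp (h k (by omega))
      rw [map_zero] at this
      refine this.congr fun N => ?_
      simp only [Function.comp_apply, map_mul, map_sum, map_div₀, map_one, map_natCast, fourier_neg]
    · subst hn
      refine tendsto_const_nhds.congr' ?_
      filter_upwards [hL (eventually_gt_atTop 0)] with N hN
      have : (N : ℂ) ≠ 0 := Nat.cast_ne_zero.2 (ne_of_gt hN)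
      simp [this]
    · rw [if_neg hn.ne']
      obtain ⟨k, rfl⟩ : ∃ k : ℕ, n = (k : ℤ) := ⟨n.natAbs, by omega⟩
      exact h k (by omega)
  have hspan : ∀ g ∈ Submodule.span ℂ (Set.range (@fourier (2 * Real.pi))),
      Tendsto (fun N : ℕ => (1 / (N : ℂ)) * ∑ j ∈ Finset.range N, g (a j)) L
        (𝓝 (∫ x, g x ∂AddCircle.haarAddCircle)) := by
    intro g hg
    induction hg using Submodule.span_induction with
    | mem g hg => obtain ⟨n, rfl⟩ := hg; exact hZ n
    | zero => simp [tendsto_const_nhds]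
    | add g₁ g₂ _ _ h₁ h₂ =>
      have e : ∫ x, (g₁ + g₂) x ∂(AddCircle.haarAddCircle (T := 2 * Real.pi)) =
          ∫ x, g₁ x ∂AddCircle.haarAddCircle + ∫ x, g₂ x ∂AddCircle.haarAddCircle :=
        integral_add (g₁.continuous.integrable_of_hasCompactSupport (HasCompactSupport.of_compactSpace _))
          (g₂.continuous.integrable_of_hasCompactSupport (HasCompactSupport.of_compactSpace _))
      rw [e]
      refine (h₁.add h₂).congr fun N => ?_
      simp [Finset.sum_add_distrib, mul_add]
    | smul c g _ h₁ =>
      have e : ∫ x, (c • g) x ∂(AddCircle.haarAddCircle (T := 2 * Real.pi)) =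
          c * ∫ x, g x ∂AddCircle.haarAddCircle := integral_const_mul _ _
      rw [e]
      refine (h₁.const_mul c).congr fun N => ?_
      simp only [ContinuousMap.smul_apply, smul_eq_mul, ← Finset.mul_sum]
      ring
  have hf : f ∈ closure (Submodule.span ℂ (Set.range (@fourier (2 * Real.pi))) : Set _) := by
    have := span_fourier_closure_eq_top (T := 2 * Real.pi)
    rw [← Submodule.topologicalClosure_coe, this]; trivial
  rw [Metric.tendsto_nhds]
  intro ε hε
  obtain ⟨g, hg, hfg⟩ := Metric.mem_closure_iff.1 hf (ε / 3) (by positivity)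
  have hpt : ∀ x, ‖f x - g x‖ ≤ ε / 3 := fun x => by
    rw [← dist_eq_norm]; exact (ContinuousMap.dist_apply_le_dist x).trans hfg.le
  filter_upwards [(Metric.tendsto_nhds.1 (hspan g hg)) (ε / 3) (by positivity),
    hL (eventually_gt_atTop 0)] with N hN hN0
  have h1 : dist ((1 / (N : ℂ)) * ∑ j ∈ Finset.range N, f (a j))
      ((1 / (N : ℂ)) * ∑ j ∈ Finset.range N, g (a j)) ≤ ε / 3 := by
    rw [dist_eq_norm, ← mul_sub, ← Finset.sum_sub_distrib, norm_mul]
    have hN' : (0 : ℝ) < N := Nat.cast_pos.2 hN0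
    calc ‖1 / (N : ℂ)‖ * ‖∑ j ∈ Finset.range N, (f (a j) - g (a j))‖
        ≤ (1 / (N : ℝ)) * (N * (ε / 3)) := by
          rw [norm_div, norm_one, Complex.norm_natCast]
          gcongr
          refine (norm_sum_le_of_le _ fun j _ => hpt (a j)).trans ?_
          simp
      _ = ε / 3 := by field_simp
  have h2 : dist (∫ x, g x ∂(AddCircle.haarAddCircle (T := 2 * Real.pi)))
      (∫ x, f x ∂AddCircle.haarAddCircle) ≤ ε / 3 := by
    rw [dist_comm, dist_eq_norm, ← integral_sub
      (f.continuous.integrable_of_hasCompactSupport (HasCompactSupport.of_compactSpace _))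
      (g.continuous.integrable_of_hasCompactSupport (HasCompactSupport.of_compactSpace _))]
    refine (norm_integral_le_of_norm_le_const (C := ε / 3) (ae_of_all _ hpt)).trans ?_
    simp
  have h3 := dist_triangle4 ((1 / (N : ℂ)) * ∑ j ∈ Finset.range N, f (a j))
    ((1 / (N : ℂ)) * ∑ j ∈ Finset.range N, g (a j))
    (∫ x, g x ∂(AddCircle.haarAddCircle (T := 2 * Real.pi))) (∫ x, f x ∂AddCircle.haarAddCircle)
  linarith

/-- Two reals at distance less than the period with the same image in the circle are equal. -/
theorem eq_of_coe_eq_of_abs_lt {s t : ℝ} (h : (s : AddCircle (2 * Real.pi)) = t)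
    (hst : |s - t| < 2 * Real.pi) : s = t := by
  have h' : ((s - t : ℝ) : AddCircle (2 * Real.pi)) = 0 := by
    rw [AddCircle.coe_sub, h, sub_self]
  obtain ⟨n, hn⟩ := (AddCircle.coe_eq_zero_iff _).1 h'
  have hpi := Real.two_pi_pos
  have : |(n : ℝ)| < 1 := by
    rw [← hn, zsmul_eq_mul, abs_mul, abs_of_pos hpi] at hst
    nlinarith
  have hn0 : n = 0 := by
    rw [← Int.cast_abs] at this
    exact Int.abs_lt_one_iff.1 (by exact_mod_cast this)
  rw [hn0] at hn
  simp at hn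
  linarith

open MeasureTheory in
/-- The normalised measure of a closed arc. -/
theorem haarAddCircle_real_arc {x y : ℝ} (hxy : x ≤ y) (hy : y - x < 2 * Real.pi) :
    (AddCircle.haarAddCircle (T := 2 * Real.pi)).real
      ((fun t : ℝ => (t : AddCircle (2 * Real.pi))) '' Set.Icc x y) = (y - x) / (2 * Real.pi) := by
  have hpi := Real.two_pi_pos
  set E := (fun t : ℝ => (t : AddCircle (2 * Real.pi))) '' Set.Icc x y
  have hE : IsClosed E := (isCompact_Icc.image (AddCircle.continuous_mk' _)).isClosed
  -- The fundamental interval is centred at the midpoint of `[x, y]`, so it contains the whole arc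
  -- because `y - x < 2π`.
  have hmp := AddCircle.measurePreserving_mk (2 * Real.pi) ((y - 2 * Real.pi + x) / 2)
  have h1 := hmp.measure_preimage hE.measurableSet.nullMeasurableSet
  have h2 : (QuotientAddGroup.mk ⁻¹' E : Set ℝ) ∩
      Set.Ioc ((y - 2 * Real.pi + x) / 2) ((y - 2 * Real.pi + x) / 2 + 2 * Real.pi)
      = Set.Icc x y := by
    ext θ
    constructor
    · rintro ⟨⟨t, ht, hteq⟩, hθ⟩
      have : t = θ := eq_of_coe_eq_of_abs_lt hteq (by
        rw [abs_lt]; constructor <;> linarith [ht.1, ht.2, hθ.1, hθ.2])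
      exact this ▸ ht
    · intro hθ
      exact ⟨⟨θ, hθ, rfl⟩, by linarith [hθ.1], by linarith [hθ.2]⟩
  rw [Measure.restrict_apply (hE.measurableSet.preimage hmp.measurable), h2, Real.volume_Icc,
    AddCircle.volume_eq_smul_haarAddCircle, Measure.smul_apply, smul_eq_mul] at h1
  have h3 := congrArg ENNReal.toReal h1
  rw [ENNReal.toReal_mul, ENNReal.toReal_ofReal (by linarith),
    ENNReal.toReal_ofReal hpi.le] at h3
  rw [eq_div_iff hpi.ne', h3, mul_comm]
  rfl

open MeasureTheory in
/-- **Weyl's criterion** for angles in `[0, 2π)`, along an arbitrary filter. -/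
theorem equidistributedAlong_of_weyl_sums {L : Filter ℕ} (hL : L ≤ atTop) (θ : ℕ → ℝ)
    (hθ : ∀ j, θ j ∈ Set.Ico 0 (2 * Real.pi))
    (h : ∀ n : ℕ, 0 < n → Tendsto (fun N : ℕ =>
      (1 / (N : ℂ)) * ∑ j ∈ Finset.range N,
        fourier (n : ℤ) (θ j : AddCircle (2 * Real.pi))) L (𝓝 0)) :
    EquidistributedAlong L θ := by
  intro x y hx hxy hy
  set E := (fun t : ℝ => (t : AddCircle (2 * Real.pi))) '' Set.Icc x y with hEdef
  have hE : IsClosed E := (isCompact_Icc.image (AddCircle.continuous_mk' _)).isClosed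
  have hmem : ∀ j, (θ j : AddCircle (2 * Real.pi)) ∈ E ↔ θ j ∈ Set.Icc x y := by
    intro j
    constructor
    · rintro ⟨t, ht, hteq⟩
      have : t = θ j := eq_of_coe_eq_of_abs_lt hteq (by
        rw [abs_lt]; constructor <;> linarith [ht.1, ht.2, (hθ j).1, (hθ j).2])
      exact this ▸ ht
    · intro hj
      exact ⟨θ j, hj, rfl⟩
  -- The condition `N ≠ 0` sits inside the existential so that `choose` yields a total family; the
  -- value at `N = 0` is arbitrary and invisible to `L ≤ atTop`.
  have hex : ∀ N : ℕ, ∃ μ : ProbabilityMeasure (AddCircle (2 * Real.pi)), N ≠ 0 →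
      (∀ f : AddCircle (2 * Real.pi) → ℂ, ∫ x, f x ∂(μ : Measure _) =
        (1 / (N : ℂ)) * ∑ j ∈ Finset.range N, f (θ j)) ∧
      ∀ s : Set (AddCircle (2 * Real.pi)), MeasurableSet s → (μ : Measure _).real s =
        (1 / (N : ℝ)) * ∑ j ∈ Finset.range N, s.indicator (fun _ => (1 : ℝ)) (θ j) := by
    intro N
    by_cases hN : N = 0
    · exact ⟨⟨AddCircle.haarAddCircle, inferInstance⟩, fun h => absurd hN h⟩
    · obtain ⟨μ, hμ⟩ := exists_empirical_measure
        (fun j => (θ j : AddCircle (2 * Real.pi))) hN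
      exact ⟨μ, fun _ => hμ⟩
  choose μ hμ using hex
  let η : ProbabilityMeasure (AddCircle (2 * Real.pi)) := ⟨AddCircle.haarAddCircle, inferInstance⟩
  have hlim : Tendsto μ L (𝓝 η) := by
    rw [ProbabilityMeasure.tendsto_iff_forall_integral_rclike_tendsto ℂ]
    intro f
    refine (tendsto_average_of_weyl_sums hL _ h f.toContinuousMap).congr' ?_
    filter_upwards [hL (eventually_gt_atTop 0)] with N hN
    exact ((hμ N (ne_of_gt hN)).1 f).symm
  -- Weak convergence gives convergence on sets with null frontier; the frontier of an arc consists
  -- of at most its two endpoints, and a point is a degenerate arc.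
  have hfront : (η : Measure (AddCircle (2 * Real.pi))) (frontier E) = 0 := by
    have hsub : frontier E ⊆ {(x : AddCircle (2 * Real.pi)), (y : AddCircle (2 * Real.pi))} := by
      rintro _ ⟨hcl, hint⟩
      rw [hE.closure_eq] at hcl
      obtain ⟨t, ht, rfl⟩ := hcl
      by_contra hne
      have hne' : t ≠ x ∧ t ≠ y := by
        constructor <;> rintro rfl <;> simp at hne
      refine hint (mem_interior.2 ⟨(fun t : ℝ => (t : AddCircle (2 * Real.pi))) '' Set.Ioo x y,
        Set.image_mono Set.Ioo_subset_Icc_self, QuotientAddGroup.isOpenMap_coe _ isOpen_Ioo,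
        ⟨t, ⟨lt_of_le_of_ne ht.1 hne'.1.symm, lt_of_le_of_ne ht.2 hne'.2⟩, rfl⟩⟩)
    have hpt : ∀ t : ℝ,
        AddCircle.haarAddCircle ({(t : AddCircle (2 * Real.pi))} : Set _) = 0 := by
      intro t
      have := haarAddCircle_real_arc (le_refl t) (by simpa using Real.two_pi_pos)
      rw [Set.Icc_self, Set.image_singleton, sub_self, zero_div] at this
      exact (measureReal_eq_zero_iff).1 this
    refine measure_mono_null hsub ?_
    change AddCircle.haarAddCircle _ = 0
    rw [Set.insert_eq]
    exact measure_union_null (hpt x) (hpt y)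
  have hfin := (ENNReal.tendsto_toReal (measure_ne_top _ _)).comp
    (ProbabilityMeasure.tendsto_measure_of_null_frontier_of_tendsto' hlim hfront)
  have hval : ((η : Measure (AddCircle (2 * Real.pi))) E).toReal = (y - x) / (2 * Real.pi) :=
    haarAddCircle_real_arc hxy.le (by linarith)
  rw [hval] at hfin
  refine hfin.congr' ?_
  filter_upwards [hL (eventually_gt_atTop 0)] with N hN
  refine ((hμ N (ne_of_gt hN)).2 E hE.measurableSet).trans ?_
  congr 1
  refine Finset.sum_congr rfl fun j _ => ?_
  by_cases hj : θ j ∈ Set.Icc x y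
  · rw [Set.indicator_of_mem hj, Set.indicator_of_mem ((hmem j).2 hj)]
  · rw [Set.indicator_of_notMem hj, Set.indicator_of_notMem (fun h => hj ((hmem j).1 h))]

/-! ### Orientations as powers of unit complex numbers. -/

namespace Tile

variable {m : ℕ}

theorem orientation_mem_Ico (T : Tile m) : T.orientation ∈ Set.Ico 0 (2 * Real.pi) := by
  simpa [orientation] using toIcoMod_mem_Ico Real.two_pi_pos 0 (Complex.arg (T.rot : ℂ))

theorem circleExp_orientation (T : Tile m) : Circle.exp T.orientation = T.rot := by
  have h : Circle.exp T.orientation = Circle.exp (Complex.arg (T.rot : ℂ)) := by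
    rw [orientation, ← self_sub_toIcoDiv_zsmul, zsmul_eq_mul, Circle.exp_sub,
      Circle.exp_int_mul_two_pi, div_one]
  rw [h, Circle.exp_arg]

theorem fourier_orientation (T : Tile m) (n : ℕ) :
    fourier (n : ℤ) (T.orientation : AddCircle (2 * Real.pi)) = (T.rot : ℂ) ^ n := by
  rw [← T.circleExp_orientation, fourier_coe_apply, Circle.coe_exp, ← Complex.exp_nat_mul]
  congr 1
  have : (Real.pi : ℂ) ≠ 0 := by exact_mod_cast Real.pi_ne_zero
  push_cast
  field_simp

end Tile

/-- The orientations of a sequence of tiles are equidistributed as soon as the averages of all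
positive powers of the rotations tend to zero. -/
theorem equidistributedAlong_orientation {m : ℕ} {L : Filter ℕ} (hL : L ≤ atTop) (e : ℕ → Tile m)
    (h : ∀ n : ℕ, 0 < n → Tendsto (fun N : ℕ =>
      ‖∑ j ∈ Finset.range N, ((e j).rot : ℂ) ^ n‖ / N) L (𝓝 0)) :
    EquidistributedAlong L (fun j => (e j).orientation) := by
  refine equidistributedAlong_of_weyl_sums hL _ (fun j => (e j).orientation_mem_Ico) fun n hn => ?_
  rw [tendsto_zero_iff_norm_tendsto_zero]
  refine (h n hn).congr fun N => ?_
  simp only [Tile.fourier_orientation, norm_mul, norm_div, norm_one, Complex.norm_natCast]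
  ring

/-! ### Balanced rearrangements of sequences on the circle. -/

/-- A finite coloured sequence can be rearranged such that every initial segment contains each
colour in almost exactly the right proportion. -/
theorem exists_perm_balanced_colours {ι : Type*} [Fintype ι] [DecidableEq ι] {M : ℕ}
    (c : Fin M → ι) :
    ∃ σ : Equiv.Perm (Fin M), ∀ s : ℕ, s ≤ M → ∀ a : ι,
      |((Finset.univ.filter fun i : Fin M => (i : ℕ) < s ∧ c (σ i) = a).card : ℝ) -
        s * (Finset.univ.filter fun i : Fin M => c i = a).card / M| ≤ Fintype.card ι + 1 := by
  classical
  let cnt : ι → ℕ := fun a => (Finset.univ.filter fun i : Fin M => c i = a).card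
  let rank : Fin M → ℕ := fun t => (Finset.univ.filter fun i : Fin M => i ≤ t ∧ c i = c t).card
  -- The elements of a colour `a` receive the evenly spaced keys `1 / cnt a, 2 / cnt a, …, 1`.
  -- Sorting by key interleaves the colours proportionally: about `x * cnt a` elements of each
  -- colour have key at most `x`.
  let key : Fin M → ℝ := fun t => rank t / cnt (c t)
  have rank_pos : ∀ t, 1 ≤ rank t := fun t => Finset.card_pos.2 ⟨t, by simp⟩
  have rank_le : ∀ t, rank t ≤ cnt (c t) := fun t =>
    Finset.card_le_card fun i hi => by
      simp only [Finset.mem_filter, Finset.mem_univ, true_and] at hi ⊢; exact hi.2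
  have cnt_pos : ∀ t, 0 < cnt (c t) := fun t => (rank_pos t).trans (rank_le t)
  have rank_lt : ∀ t t', c t = c t' → t < t' → rank t < rank t' := by
    intro t t' hc htt
    refine Finset.card_lt_card ⟨fun i hi => ?_, fun hsub => ?_⟩
    · simp only [Finset.mem_filter, Finset.mem_univ, true_and] at hi ⊢
      exact ⟨hi.1.trans htt.le, hi.2.trans hc⟩
    · have := hsub (x := t') (by simp)
      simp only [Finset.mem_filter, Finset.mem_univ, true_and] at this
      exact absurd this.1 (not_le.2 htt)
  have rank_inj : ∀ a, Set.InjOn rank {t | c t = a} := by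
    intro a t ht t' ht' h
    have hc : c t = c t' := ht.trans ht'.symm
    rcases lt_trichotomy t t' with hlt | heq | hgt
    · exact absurd h (rank_lt t t' hc hlt).ne
    · exact heq
    · exact absurd h (rank_lt t' t hc.symm hgt).ne'
  have upper : ∀ (x : ℝ), 0 ≤ x → ∀ a,
      ((Finset.univ.filter fun t : Fin M => key t ≤ x ∧ c t = a).card : ℝ) ≤ x * cnt a := by
    intro x hx a
    have h1 : (Finset.univ.filter fun t : Fin M => key t ≤ x ∧ c t = a).card ≤
        (Finset.Icc 1 ⌊x * cnt a⌋₊).card := by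
      refine Finset.card_le_card_of_injOn rank (fun t ht => ?_) (fun t ht t' ht' h => ?_)
      · simp only [Finset.coe_filter, Finset.mem_univ, true_and, Set.mem_ofPred_eq] at ht
        obtain ⟨hk, rfl⟩ := ht
        refine Finset.mem_coe.2 (Finset.mem_Icc.2 ⟨rank_pos t, Nat.le_floor ?_⟩)
        exact (div_le_iff₀ (Nat.cast_pos.2 (cnt_pos t))).1 hk
      · simp only [Finset.coe_filter, Finset.mem_univ, true_and, Set.mem_ofPred_eq] at ht ht'
        exact rank_inj a ht.2 ht'.2 h
    rw [Nat.card_Icc, Nat.add_sub_cancel] at h1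
    exact (Nat.cast_le.2 h1).trans (Nat.floor_le (by positivity))
  have lower : ∀ (x : ℝ), x ≤ 1 → ∀ a,
      x * cnt a - 1 ≤ ((Finset.univ.filter fun t : Fin M => key t < x ∧ c t = a).card : ℝ) := by
    intro x hx a
    have h1 : (Finset.univ.filter fun t : Fin M => ¬ key t < x ∧ c t = a).card ≤
        (Finset.Icc ⌈x * cnt a⌉₊ (cnt a)).card := by
      refine Finset.card_le_card_of_injOn rank (fun t ht => ?_) (fun t ht t' ht' h => ?_)
      · simp only [Finset.coe_filter, Finset.mem_univ, true_and, Set.mem_ofPred_eq, not_lt] at ht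
        obtain ⟨hk, rfl⟩ := ht
        refine Finset.mem_coe.2 (Finset.mem_Icc.2 ⟨Nat.ceil_le.2 ?_, rank_le t⟩)
        exact (le_div_iff₀ (Nat.cast_pos.2 (cnt_pos t))).1 hk
      · simp only [Finset.coe_filter, Finset.mem_univ, true_and, Set.mem_ofPred_eq] at ht ht'
        exact rank_inj a ht.2 ht'.2 h
    have h2 : (Finset.univ.filter fun t : Fin M => key t < x ∧ c t = a).card +
        (Finset.univ.filter fun t : Fin M => ¬ key t < x ∧ c t = a).card = cnt a := by
      have := Finset.card_filter_add_card_filter_not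
        (s := Finset.univ.filter fun t : Fin M => c t = a) (fun t => key t < x)
      rw [Finset.filter_filter, Finset.filter_filter] at this
      simpa only [and_comm] using this
    have h3 : ⌈x * cnt a⌉₊ ≤ cnt a := Nat.ceil_le.2 (mul_le_of_le_one_left (Nat.cast_nonneg _) hx)
    rw [Nat.card_Icc] at h1
    have h4 : ⌈x * cnt a⌉₊ ≤
        (Finset.univ.filter fun t : Fin M => key t < x ∧ c t = a).card + 1 := by omega
    have h5 : x * cnt a ≤
        ((Finset.univ.filter fun t : Fin M => key t < x ∧ c t = a).card : ℝ) + 1 :=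
      (Nat.le_ceil _).trans (by exact_mod_cast h4)
    linarith
  refine ⟨Tuple.sort key, fun s hs a => ?_⟩
  set σ := Tuple.sort key
  have hmono : Monotone (key ∘ σ) := Tuple.monotone_sort key
  rcases Nat.eq_zero_or_pos s with rfl | hspos
  · simp only [not_lt_zero, false_and, Finset.filter_false, Finset.card_empty, Nat.cast_zero,
      zero_mul, zero_div, sub_zero, abs_zero]
    positivity
  let last : Fin M := ⟨s - 1, by omega⟩
  -- The first `s` sorted elements include all keys below `x` and no key above it, so every colour
  -- count lies between `x * cnt a - 1` and `x * cnt a`. Summing over the colours determines `x * M`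
  -- from `s` up to the number of colours.
  set x := key (σ last)
  have hx0 : 0 ≤ x := by positivity
  have hx1 : x ≤ 1 := div_le_one_of_le₀ (Nat.cast_le.2 (rank_le _)) (Nat.cast_nonneg _)
  let num : ι → ℕ := fun a =>
    (Finset.univ.filter fun i : Fin M => (i : ℕ) < s ∧ c (σ i) = a).card
  have num_le : ∀ a, (num a : ℝ) ≤ x * cnt a := by
    intro a
    refine le_trans (Nat.cast_le.2 ?_) (upper x hx0 a)
    refine Finset.card_le_card_of_injOn σ (fun i hi => ?_) σ.injective.injOn
    simp only [Finset.coe_filter, Finset.mem_univ, true_and, Set.mem_ofPred_eq] at hi ⊢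
    exact ⟨hmono (show i ≤ last from Fin.le_def.2 (by simp only [last]; omega)), hi.2⟩
  have le_num : ∀ a, x * cnt a - 1 ≤ (num a : ℝ) := by
    intro a
    refine le_trans (lower x hx1 a) (Nat.cast_le.2 ?_)
    refine Finset.card_le_card_of_injOn σ.symm (fun t ht => ?_) σ.symm.injective.injOn
    simp only [Finset.coe_filter, Finset.mem_univ, true_and, Set.mem_ofPred_eq,
      Equiv.apply_symm_apply] at ht ⊢
    refine ⟨?_, ht.2⟩
    by_contra hge
    have := hmono (show last ≤ σ.symm t from Fin.le_def.2 (by simp only [last]; omega))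
    simp only [Function.comp_apply, Equiv.apply_symm_apply] at this
    exact absurd ht.1 (not_lt.2 this)
  have sum_num : ∑ a, (num a : ℝ) = s := by
    have h := Finset.card_eq_sum_card_fiberwise (f := fun i => c (σ i))
      (s := Finset.univ.filter fun i : Fin M => (i : ℕ) < s) (t := Finset.univ)
      (fun _ _ => Finset.mem_coe.2 (Finset.mem_univ _))
    simp only [Finset.filter_filter] at h
    have h' : (Finset.univ.filter fun i : Fin M => (i : ℕ) < s).card = s := by
      rw [Fin.card_filter_val_lt]; omega
    rw [h'] at h
    exact_mod_cast h.symm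
  have sum_cnt : ∑ a, (cnt a : ℝ) = M := by
    have h := Finset.card_eq_sum_card_fiberwise (f := c)
      (s := (Finset.univ : Finset (Fin M))) (t := Finset.univ)
      (fun _ _ => Finset.mem_coe.2 (Finset.mem_univ _))
    rw [Finset.card_univ, Fintype.card_fin] at h
    exact_mod_cast h.symm
  have hMpos : (0 : ℝ) < M := Nat.cast_pos.2 (hspos.trans_le hs)
  have s_le : (s : ℝ) ≤ x * M := by
    rw [← sum_num, ← sum_cnt, Finset.mul_sum]
    exact Finset.sum_le_sum fun a _ => num_le a
  have le_s : x * M - Fintype.card ι ≤ (s : ℝ) := by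
    rw [← sum_num, ← sum_cnt, Finset.mul_sum]
    have := Finset.sum_le_sum fun a (_ : a ∈ Finset.univ) => le_num a
    rw [Finset.sum_sub_distrib] at this
    simpa using this
  have cnt_le : (cnt a : ℝ) / M ≤ 1 := by
    rw [div_le_one hMpos, ← sum_cnt]
    exact Finset.single_le_sum (f := fun a => (cnt a : ℝ)) (fun _ _ => Nat.cast_nonneg _)
      (Finset.mem_univ a)
  have hr0 : 0 ≤ (cnt a : ℝ) / M := by positivity
  have hcnt : (cnt a : ℝ) = cnt a / M * M := by field_simp
  change |(num a : ℝ) - s * cnt a / M| ≤ _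
  have h1 := num_le a
  have h2 := le_num a
  rw [mul_div_assoc]
  generalize (cnt a : ℝ) / M = ρ at *
  rw [hcnt] at h1 h2
  have h3 := mul_le_mul_of_nonneg_right s_le hr0
  have h4 := mul_le_mul_of_nonneg_right le_s hr0
  have h5 : (Fintype.card ι : ℝ) * ρ ≤ Fintype.card ι :=
    mul_le_of_le_one_right (Nat.cast_nonneg _) cnt_le
  rw [abs_le]
  constructor <;> nlinarith

/-- Rearranging a finite sequence of complex numbers, each close to the value assigned to its
colour, such that all partial sums grow almost linearly. -/
theorem exists_perm_balanced_sums {ι : Type*} [Fintype ι] {M : ℕ} (c : Fin M → ι) :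
    ∃ σ : Equiv.Perm (Fin M), ∀ (g : Fin M → ℂ) (w : ι → ℂ) (ω : ℝ), (∀ a, ‖w a‖ ≤ 1) →
      (∀ t, ‖g t - w (c t)‖ ≤ ω) → ∀ s : ℕ, s ≤ M →
      ‖∑ i ∈ Finset.univ.filter (fun i : Fin M => (i : ℕ) < s), g (σ i) - (s / M : ℝ) * ∑ t, g t‖ ≤
        2 * ω * s + Fintype.card ι * (Fintype.card ι + 1) := by
  classical
  obtain ⟨σ, hσ⟩ := exists_perm_balanced_colours c
  refine ⟨σ, fun g w ω hw hg s hs => ?_⟩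
  have hcard : (Finset.univ.filter fun i : Fin M => (i : ℕ) < s).card = s := by
    rw [Fin.card_filter_val_lt]; omega
  have e1 : ∑ i ∈ Finset.univ.filter (fun i : Fin M => (i : ℕ) < s), w (c (σ i)) = ∑ a,
      ((Finset.univ.filter fun i : Fin M => (i : ℕ) < s ∧ c (σ i) = a).card : ℂ) * w a := by
    rw [← Finset.sum_fiberwise_of_maps_to (g := fun i => c (σ i)) (t := Finset.univ)
      (fun _ _ => Finset.mem_univ _)]
    refine Finset.sum_congr rfl fun a _ => ?_
    rw [Finset.filter_filter, ← nsmul_eq_mul]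
    refine Finset.sum_eq_card_nsmul fun i hi => ?_
    rw [(Finset.mem_filter.1 hi).2.2]
  have e2 : ∑ t, w (c t) = ∑ a,
      ((Finset.univ.filter fun i : Fin M => c i = a).card : ℂ) * w a := by
    rw [← Finset.sum_fiberwise_of_maps_to (g := c) (t := Finset.univ)
      (fun _ _ => Finset.mem_univ _)]
    refine Finset.sum_congr rfl fun a _ => ?_
    rw [← nsmul_eq_mul]
    refine Finset.sum_eq_card_nsmul fun i hi => ?_
    rw [(Finset.mem_filter.1 hi).2]
  have b1 : ‖∑ i ∈ Finset.univ.filter (fun i : Fin M => (i : ℕ) < s), g (σ i) - ∑ i ∈ Finset.univ.filter (fun i : Fin M => (i : ℕ) < s), w (c (σ i))‖ ≤ ω * s := by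
    rw [← Finset.sum_sub_distrib]
    refine (norm_sum_le_of_le _ fun i _ => hg (σ i)).trans ?_
    rw [Finset.sum_const, hcard, nsmul_eq_mul, mul_comm]
  have b2 : ‖∑ i ∈ Finset.univ.filter (fun i : Fin M => (i : ℕ) < s), w (c (σ i)) - (s / M : ℝ) * ∑ t, w (c t)‖ ≤
      Fintype.card ι * (Fintype.card ι + 1) := by
    rw [e1, e2, Finset.mul_sum, ← Finset.sum_sub_distrib]
    refine (norm_sum_le_of_le (f := _) (n := fun _ => (Fintype.card ι + 1 : ℝ)) _
      fun a _ => ?_).trans (by simp [mul_add])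
    have : ((Finset.univ.filter fun i : Fin M => (i : ℕ) < s ∧ c (σ i) = a).card : ℂ) * w a -
        ((s / M : ℝ) : ℂ) * (((Finset.univ.filter fun i : Fin M => c i = a).card : ℂ) * w a) =
        ((((Finset.univ.filter fun i : Fin M => (i : ℕ) < s ∧ c (σ i) = a).card : ℝ) -
        s * (Finset.univ.filter fun i : Fin M => c i = a).card / M : ℝ) : ℂ) * w a := by
      push_cast; ring
    rw [this, norm_mul, Complex.norm_real, Real.norm_eq_abs]
    exact (mul_le_of_le_one_right (abs_nonneg _) (hw a)).trans (hσ s hs a)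
  have b3 : ‖((s / M : ℝ) : ℂ) * ∑ t, w (c t) - (s / M : ℝ) * ∑ t, g t‖ ≤ ω * s := by
    rw [← mul_sub, ← Finset.sum_sub_distrib, norm_mul, Complex.norm_real, Real.norm_eq_abs,
      abs_of_nonneg (by positivity)]
    have h : ‖∑ t, (w (c t) - g t)‖ ≤ M * ω := by
      refine (norm_sum_le_of_le _ fun t _ => (norm_sub_rev _ _).trans_le (hg t)).trans ?_
      simp
    rcases Nat.eq_zero_or_pos M with h0 | hM
    · have : s = 0 := by omega
      simp [this]
    · have hM' : (0 : ℝ) < M := Nat.cast_pos.2 hM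
      calc (s / M : ℝ) * ‖∑ t, (w (c t) - g t)‖ ≤ s / M * (M * ω) := by gcongr
        _ = ω * s := by field_simp
  calc _ ≤ _ := norm_sub_le_norm_sub_add_norm_sub _ (∑ i ∈ Finset.univ.filter (fun i : Fin M => (i : ℕ) < s), w (c (σ i))) _
    _ ≤ _ := add_le_add_right (norm_sub_le_norm_sub_add_norm_sub _
        (((s / M : ℝ) : ℂ) * ∑ t, w (c t)) _) _
    _ ≤ ω * s + (Fintype.card ι * (Fintype.card ι + 1) + ω * s) := by gcongr
    _ = _ := by ring

/-- Powers on the unit circle are Lipschitz. -/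
theorem norm_circle_pow_sub_le (z w : Circle) (n : ℕ) :
    ‖(z : ℂ) ^ n - (w : ℂ) ^ n‖ ≤ n * dist z w := by
  induction n with
  | zero => simp
  | succ n ih =>
    have : (z : ℂ) ^ (n + 1) - (w : ℂ) ^ (n + 1) =
        ((z : ℂ) ^ n - (w : ℂ) ^ n) * z + (w : ℂ) ^ n * ((z : ℂ) - w) := by ring
    rw [this]
    refine (norm_add_le _ _).trans ?_
    rw [norm_mul, norm_mul, norm_pow, Circle.norm_coe, Circle.norm_coe, one_pow, mul_one, one_mul]
    push_cast
    have hd : ‖(z : ℂ) - w‖ = dist z w := by rw [← dist_eq_norm]; rfl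
    rw [hd]
    linarith

/-- For every precision `δ` there is a constant `Q` such that every block of a sequence on the
circle can be rearranged with partial Weyl sums growing linearly up to an error
`2 n δ s + Q`. -/
theorem exists_perm_block {δ : ℝ} (hδ : 0 < δ) :
    ∃ Q : ℕ, ∀ (z : ℕ → Circle) (l M : ℕ), ∃ π : Equiv.Perm ℕ,
      (∀ i < M, ∃ i' < M, π (l + i) = l + i') ∧ (∀ i < M, ∃ i' < M, π.symm (l + i) = l + i') ∧
      ∀ n s : ℕ, s ≤ M →
        ‖∑ i ∈ Finset.range s, (z (π (l + i)) : ℂ) ^ n -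
          (s / M : ℝ) * ∑ i ∈ Finset.range M, (z (l + i) : ℂ) ^ n‖ ≤ 2 * (n * δ) * s + Q := by
  classical
  -- The colours are the points of a finite `δ`-net; thus `Q` below depends on `δ` alone and not on
  -- the block.
  obtain ⟨t, -, htf, htc⟩ := Metric.finite_approx_of_totallyBounded
    (isCompact_univ (X := Circle)).totallyBounded δ hδ
  have hnear : ∀ u : Circle, ∃ y : t, dist u y < δ := fun u => by
    obtain ⟨y, hy, hu⟩ := Set.mem_iUnion₂.1 (htc (Set.mem_univ u))
    exact ⟨⟨y, hy⟩, hu⟩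
  choose c hc using hnear
  have : Fintype t := htf.fintype
  refine ⟨Fintype.card t * (Fintype.card t + 1), fun z l M => ?_⟩
  -- The permutation is fixed by the colouring before the values are chosen, so it serves all
  -- exponents `n` at once.
  obtain ⟨σ, hσ⟩ := exists_perm_balanced_sums (M := M) (fun i => c (z (l + i)))
  let ι : Fin M ↪ ℕ := ⟨fun i => l + i, fun i j h => Fin.ext (Nat.add_left_cancel h)⟩
  have hπ : ∀ (τ : Equiv.Perm (Fin M)) (i : Fin M), τ.viaEmbedding ι (l + i) = l + τ i :=
    fun τ i => Equiv.Perm.viaEmbedding_apply τ ι i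
  refine ⟨σ.viaEmbedding ι, fun i hi => ⟨σ ⟨i, hi⟩, (σ ⟨i, hi⟩).2, hπ σ ⟨i, hi⟩⟩,
    fun i hi => ⟨σ.symm ⟨i, hi⟩, (σ.symm ⟨i, hi⟩).2, ?_⟩, fun n s hs => ?_⟩
  · rw [Equiv.symm_apply_eq, hπ, Equiv.apply_symm_apply]
  · have h := hσ (fun i => (z (l + i) : ℂ) ^ n) (fun a => ((a : Circle) : ℂ) ^ n) (n * δ)
      (fun a => by rw [norm_pow, Circle.norm_coe, one_pow]) (fun i => (norm_circle_pow_sub_le _ _ n).trans (by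
        have := (hc (z (l + i))).le
        gcongr)) s hs
    have e1 : ∑ i ∈ Finset.range s, (z (σ.viaEmbedding ι (l + i)) : ℂ) ^ n =
        ∑ i ∈ Finset.univ.filter (fun i : Fin M => (i : ℕ) < s), (z (l + σ i) : ℂ) ^ n := by
      symm
      refine Finset.sum_bij (fun i _ => (i : ℕ)) (fun i hi => ?_) (fun _ _ _ _ h => Fin.ext h)
        (fun i hi => ?_) (fun i _ => by rw [hπ])
      · exact Finset.mem_range.2 (Finset.mem_filter.1 hi).2
      · have hi' := Finset.mem_range.1 hi
        exact ⟨⟨i, hi'.trans_le hs⟩, by simpa using hi', rfl⟩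
    rw [e1, Finset.sum_range]
    push_cast at h ⊢
    exact h

/-- A sequence on the circle whose Weyl averages tend to zero along an infinite set `A` of lengths
has a rearrangement whose Weyl averages tend to zero along all lengths, and which preserves
initial segments for infinitely many lengths from `A`. -/
theorem exists_perm_weyl_sums (z : ℕ → Circle) (A : Set ℕ) (hA : ∀ n, ∃ l, n ≤ l ∧ l ∈ A)
    (h : ∀ n : ℕ, 0 < n → Tendsto (fun N : ℕ =>
      ‖∑ j ∈ Finset.range N, (z j : ℂ) ^ n‖ / N) (atTop ⊓ 𝓟 A) (𝓝 0)) :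
    ∃ π : Equiv.Perm ℕ, (∀ n, ∃ l, n ≤ l ∧ l ∈ A ∧ π '' Set.Iio l = Set.Iio l) ∧
      ∀ n : ℕ, 0 < n → Tendsto (fun N : ℕ =>
        ‖∑ j ∈ Finset.range N, (z (π j) : ℂ) ^ n‖ / N) atTop (𝓝 0) := by
  classical
  have hδ : ∀ j : ℕ, 0 < 1 / ((j : ℝ) + 1) := fun j => by positivity
  choose Q hQ using fun j => exists_perm_block (hδ j)
  choose nxt hnxt hnxtA using hA
  -- Block `j` runs from `L j` to `L (j + 1)` and uses precision `1 / (j + 1)`. The growth condition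
  -- makes each block longer than all that precedes it, and makes `Q (j + 1)` at most `L (j + 1) /
  -- (j + 2)`, so the constant error of a block is absorbed by the prefix before it.
  obtain ⟨L, hL0, hLs, hLA⟩ : ∃ L : ℕ → ℕ, L 0 = 0 ∧
      (∀ j, 2 * L j + 1 + (j + 2) * Q (j + 1) ≤ L (j + 1)) ∧ ∀ j, L (j + 1) ∈ A :=
    ⟨fun j => Nat.rec 0 (fun j l => nxt (2 * l + 1 + (j + 2) * Q (j + 1))) j, rfl,
      fun j => hnxt _, fun j => hnxtA _⟩
  have hLlt : ∀ j, L j < L (j + 1) := fun j => by have := hLs j; omega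
  have hLmono : StrictMono L := strictMono_nat_of_lt_succ hLlt
  have hblk : ∀ N, ∃ j, L j ≤ N ∧ N < L (j + 1) := by
    intro N
    obtain ⟨j, hj, hmax⟩ : ∃ j, L j ≤ N ∧ ∀ i, L i ≤ N → i ≤ j := by
      refine ⟨Nat.findGreatest (fun j => L j ≤ N) N, ?_, fun i hi => ?_⟩
      · exact Nat.findGreatest_spec (P := fun j => L j ≤ N) (Nat.zero_le N)
          (by rw [hL0]; exact Nat.zero_le N)
      · exact Nat.le_findGreatest ((hLmono.id_le i).trans hi) hi
    refine ⟨j, hj, ?_⟩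
    by_contra hge
    have := hmax (j + 1) (not_lt.1 hge)
    omega
  choose blk hblk1 hblk2 using hblk
  have hblk_unique : ∀ N j, L j ≤ N → N < L (j + 1) → blk N = j := by
    intro N j h1 h2
    have h3 := hLmono.lt_iff_lt.1 ((hblk1 N).trans_lt h2)
    have h4 := hLmono.lt_iff_lt.1 (h1.trans_lt (hblk2 N))
    omega
  choose ρ hρ1 hρ2 hρ using fun j => hQ j z (L j) (L (j + 1) - L j)
  have hstep : ∀ (τ : ℕ → Equiv.Perm ℕ), (∀ j, ∀ i < L (j + 1) - L j,
      ∃ i' < L (j + 1) - L j, τ j (L j + i) = L j + i') → ∀ N, blk (τ (blk N) N) = blk N := by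
    intro τ hτ N
    obtain ⟨i', hi', he⟩ := hτ (blk N) (N - L (blk N)) (by
      have := hblk1 N; have := hblk2 N; omega)
    rw [Nat.add_sub_cancel' (hblk1 N)] at he
    refine hblk_unique _ _ ?_ ?_ <;> omega
  have hb1 := hstep ρ hρ1
  have hb2 := hstep (fun j => (ρ j).symm) hρ2
  -- Each `ρ j` preserves its own block, so the block index of a position can be read off before or
  -- after applying it.
  let π : Equiv.Perm ℕ :=
    { toFun := fun N => ρ (blk N) N
      invFun := fun N => (ρ (blk N)).symm N
      left_inv := fun N => by simp only [hb1, Equiv.symm_apply_apply]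
      right_inv := fun N => by
        change ρ (blk ((ρ (blk N)).symm N)) ((ρ (blk N)).symm N) = N
        rw [hb2 N, Equiv.apply_symm_apply] }
  have hblk_lt : ∀ N j, N < L j ↔ blk N < j := by
    intro N j
    constructor
    · intro h
      exact hLmono.lt_iff_lt.1 ((hblk1 N).trans_lt h)
    · intro h
      exact (hblk2 N).trans_le (hLmono.monotone h)
  have hπblk : ∀ N, blk (π N) = blk N := hb1
  have hπlt : ∀ N j, π N < L j ↔ N < L j := fun N j => by rw [hblk_lt, hπblk, ← hblk_lt]
  have hπimg : ∀ j, π '' Set.Iio (L j) = Set.Iio (L j) := by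
    intro j
    ext N
    constructor
    · rintro ⟨i, hi, rfl⟩
      exact (hπlt i j).2 hi
    · intro hN
      refine ⟨π.symm N, (hπlt _ j).1 ?_, π.apply_symm_apply N⟩
      rwa [π.apply_symm_apply]
  refine ⟨π, fun n => ⟨L (n + 1), (Nat.le_succ n).trans (hLmono.id_le _), hLA n, hπimg _⟩,
    fun n hn => ?_⟩
  let η : ℕ → ℝ := fun j => ‖∑ i ∈ Finset.range (L j), (z i : ℂ) ^ n‖ / L j
  have hη : Tendsto η atTop (𝓝 0) := by
    have hLA' : Tendsto L atTop (atTop ⊓ 𝓟 A) := by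
      refine tendsto_inf.2 ⟨hLmono.tendsto_atTop, tendsto_principal.2 ?_⟩
      filter_upwards [eventually_gt_atTop 0] with j hj
      obtain ⟨i, rfl⟩ := Nat.exists_eq_succ_of_ne_zero (ne_of_gt hj)
      exact hLA i
    exact (h n hn).comp hLA'
  have hblk_top : Tendsto blk atTop atTop := by
    refine tendsto_atTop.2 fun j => ?_
    filter_upwards [eventually_ge_atTop (L j)] with N hN
    by_contra hlt
    exact absurd ((hblk_lt N j).2 (not_le.1 hlt)) (not_lt.2 hN)
  -- The old prefix contributes `η j * L j`. The new part contributes the fraction `s / M` of the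
  -- whole block sum, controlled by `L j ≤ M` and `L (j + 1) ≤ 2 * M`, plus the balancing error. The
  -- case `j = 0` is excluded because its prefix is empty and cannot absorb `Q 0`.
  have hbound : ∀ j s, 1 ≤ j → L j + s < L (j + 1) →
      ‖∑ i ∈ Finset.range (L j + s), (z (π i) : ℂ) ^ n‖ / (L j + s : ℕ) ≤
      η j + 2 * η (j + 1) + (2 * n + 1) * (1 / ((j : ℝ) + 1)) := by
    intro j s hj h2
    have hpre : ∀ j, ∑ i ∈ Finset.range (L j), (z (π i) : ℂ) ^ n =
        ∑ i ∈ Finset.range (L j), (z i : ℂ) ^ n := by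
      intro j
      refine Finset.sum_equiv π (fun i => ?_) (fun _ _ => rfl)
      rw [Finset.mem_range, Finset.mem_range, hπlt]
    have hsplit : ∑ i ∈ Finset.range (L j + s), (z (π i) : ℂ) ^ n =
        ∑ i ∈ Finset.range (L j), (z i : ℂ) ^ n +
          ∑ i ∈ Finset.range s, (z (ρ j (L j + i)) : ℂ) ^ n := by
      rw [Finset.sum_range_add, hpre]
      congr 1
      refine Finset.sum_congr rfl fun i hi => ?_
      have hi' := Finset.mem_range.1 hi
      have : blk (L j + i) = j := hblk_unique _ _ (by omega) (by omega)
      change (z (ρ (blk (L j + i)) (L j + i)) : ℂ) ^ n = _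
      rw [this]
    have hM : L j + (L (j + 1) - L j) = L (j + 1) := Nat.add_sub_cancel' (hLlt j).le
    have hwhole : ∑ i ∈ Finset.range (L (j + 1) - L j), (z (L j + i) : ℂ) ^ n =
        ∑ i ∈ Finset.range (L (j + 1)), (z i : ℂ) ^ n -
          ∑ i ∈ Finset.range (L j), (z i : ℂ) ^ n := by
      rw [← hM, Finset.sum_range_add, add_sub_cancel_left, hM]
    have hb := hρ j n s (by omega)
    rw [hwhole] at hb
    have hLj : 0 < L j := by
      have := hLmono (show 0 < j by omega)
      omega
    have hLjR : (0 : ℝ) < L j := Nat.cast_pos.2 hLj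
    have hLj1R : (0 : ℝ) < L (j + 1) := Nat.cast_pos.2 (hLj.trans (hLlt j))
    have hη1 : ‖∑ i ∈ Finset.range (L j), (z i : ℂ) ^ n‖ = η j * L j := by
      simp only [η]; field_simp
    have hη2 : ‖∑ i ∈ Finset.range (L (j + 1)), (z i : ℂ) ^ n‖ = η (j + 1) * L (j + 1) := by
      simp only [η]; field_simp
    have hη1' : 0 ≤ η j := by positivity
    have hη2' : 0 ≤ η (j + 1) := by positivity
    have hQj : (Q j : ℝ) ≤ L j * (1 / ((j : ℝ) + 1)) := by
      obtain ⟨i, hi⟩ := Nat.exists_eq_succ_of_ne_zero (show j ≠ 0 by omega)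
      have := hLs i
      rw [← Nat.succ_eq_add_one i, ← hi] at this
      have h3 : (j + 1) * Q j ≤ L j := by
        have e : i + 2 = j + 1 := by omega
        rw [e] at this
        omega
      rw [mul_one_div, le_div_iff₀ (by positivity), mul_comm]
      exact_mod_cast h3
    have hMle1 : L j ≤ L (j + 1) - L j := by have := hLs j; omega
    have hMle2 : L (j + 1) ≤ 2 * (L (j + 1) - L j) := by have := hLs j; omega
    have hMpos : (0 : ℝ) < (L (j + 1) - L j : ℕ) := Nat.cast_pos.2 (by omega)
    set M := L (j + 1) - L j
    have hr1 : (s / M : ℝ) * L j ≤ s := by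
      rw [div_mul_eq_mul_div, div_le_iff₀ hMpos]
      have : (L j : ℝ) ≤ M := Nat.cast_le.2 hMle1
      gcongr
    have hr2 : (s / M : ℝ) * L (j + 1) ≤ 2 * s := by
      rw [div_mul_eq_mul_div, div_le_iff₀ hMpos]
      have : (L (j + 1) : ℝ) ≤ 2 * M := by exact_mod_cast hMle2
      calc (s : ℝ) * L (j + 1) ≤ s * (2 * M) := by gcongr
        _ = _ := by ring
    have hmid : ‖((s / M : ℝ) : ℂ) * (∑ i ∈ Finset.range (L (j + 1)), (z i : ℂ) ^ n -
          ∑ i ∈ Finset.range (L j), (z i : ℂ) ^ n)‖ ≤ 2 * s * η (j + 1) + s * η j := by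
      rw [norm_mul, Complex.norm_real, Real.norm_eq_abs, abs_of_nonneg (by positivity)]
      calc (s / M : ℝ) * ‖∑ i ∈ Finset.range (L (j + 1)), (z i : ℂ) ^ n -
            ∑ i ∈ Finset.range (L j), (z i : ℂ) ^ n‖
          ≤ (s / M : ℝ) * (η (j + 1) * L (j + 1) + η j * L j) := by
            rw [← hη1, ← hη2]
            gcongr
            exact norm_sub_le _ _
        _ = (s / M : ℝ) * L (j + 1) * η (j + 1) + (s / M : ℝ) * L j * η j := by ring
        _ ≤ _ := by gcongr
    have hblock : ‖∑ i ∈ Finset.range s, (z (ρ j (L j + i)) : ℂ) ^ n‖ ≤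
        2 * s * η (j + 1) + s * η j + (2 * (n * (1 / ((j : ℝ) + 1))) * s + Q j) := by
      have := norm_le_norm_add_norm_sub' (∑ i ∈ Finset.range s, (z (ρ j (L j + i)) : ℂ) ^ n)
        (((s / M : ℝ) : ℂ) * (∑ i ∈ Finset.range (L (j + 1)), (z i : ℂ) ^ n -
          ∑ i ∈ Finset.range (L j), (z i : ℂ) ^ n))
      linarith
    rw [div_le_iff₀ (by push_cast; positivity), hsplit]
    refine (norm_add_le _ _).trans ?_
    rw [hη1]
    push_cast
    generalize hd : 1 / ((j : ℝ) + 1) = d at *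
    have hd0 : 0 ≤ d := by rw [← hd]; positivity
    have hs0 : (0 : ℝ) ≤ s := Nat.cast_nonneg _
    have t1 := mul_nonneg hη2' hLjR.le
    have t2 := mul_nonneg hd0 hs0
    have t3 := mul_nonneg (mul_nonneg (Nat.cast_nonneg (α := ℝ) n) hd0) hLjR.le
    nlinarith
  have hlim : Tendsto (fun j : ℕ => η j + 2 * η (j + 1) + (2 * n + 1) * (1 / ((j : ℝ) + 1)))
      atTop (𝓝 0) := by
    have := (hη.add ((hη.comp (tendsto_add_atTop_nat 1)).const_mul 2)).add
      (tendsto_one_div_add_atTop_nhds_zero_nat.const_mul (2 * (n : ℝ) + 1))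
    simpa using this
  refine squeeze_zero' (Eventually.of_forall fun N => by positivity) ?_ (hlim.comp hblk_top)
  filter_upwards [hblk_top.eventually_ge_atTop 1] with N hN
  obtain ⟨s, hs⟩ := Nat.exists_eq_add_of_le (hblk1 N)
  have hN2 := hblk2 N
  have := hbound (blk N) s hN (hs ▸ hN2)
  rwa [← hs] at this

/-! ### Motions, supertiles as finite patches, and their hierarchy. -/

namespace Tile

variable {m : ℕ}

/-- The direct Euclidean motion `z ↦ R z + t`. -/
def motion (R : Circle) (t : ℂ) : ℂ ≃ᵢ ℂ :=
  (rotation R).toIsometryEquiv.trans (IsometryEquiv.addRight t)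

theorem motion_apply (R : Circle) (t z : ℂ) : motion R t z = R * z + t := rfl

theorem carrier_eq_motion_image (P : Fin m → Set ℂ) (T : Tile m) :
    T.carrier P = motion T.rot T.trans '' P T.idx := rfl

theorem move_move (R R' : Circle) (t t' : ℂ) (T : Tile m) :
    move R t (move R' t' T) = move (R * R') (R * t' + t) T := by
  ext
  · rfl
  · simp [move, mul_assoc]
  · simp [move]; ring

theorem move_one_zero (T : Tile m) : move 1 0 T = T := by
  ext <;> simp [move]

theorem move_injective (R : Circle) (t : ℂ) : Function.Injective (move (m := m) R t) := by
  intro T T' h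
  have h1 := congrArg idx h
  have h2 := congrArg rot h
  have h3 := congrArg trans h
  simp only [move, mul_right_inj, add_left_inj] at h1 h2 h3
  exact Tile.ext h1 h2 (mul_left_cancel₀ R.coe_ne_zero h3)

theorem eq_move (T : Tile m) : T = move T.rot T.trans ⟨T.idx, 1, 0⟩ := by
  ext <;> simp [move]

theorem carrier_move (P : Fin m → Set ℂ) (R : Circle) (t : ℂ) (T : Tile m) :
    (move R t T).carrier P = motion R t '' T.carrier P := by
  rw [carrier, carrier, Set.image_image]
  refine Set.image_congr fun z _ => ?_
  simp only [move, motion_apply, Circle.coe_mul]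
  ring

end Tile

namespace TileSubstitution

variable {m : ℕ} (S : TileSubstitution m)

theorem scale_pos : 0 < S.scale := one_pos.trans S.one_lt_scale

theorem scale_ne_zero : (S.scale : ℂ) ≠ 0 := Complex.ofReal_ne_zero.2 S.scale_pos.ne'

open Classical in
/-- The substitution as a map on finite patches. -/
def substFin (F : Finset (Tile m)) : Finset (Tile m) :=
  F.biUnion fun T => (S.subst T.idx).image (Tile.move T.rot ((S.scale : ℂ) * T.trans))

/-- The supertile of order `k` generated by the tile `T`. -/
def patch (k : ℕ) (T : Tile m) : Finset (Tile m) := S.substFin^[k] {T}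

theorem mem_substFin {F : Finset (Tile m)} {U : Tile m} :
    U ∈ S.substFin F ↔ ∃ T ∈ F, ∃ V ∈ S.subst T.idx,
      Tile.move T.rot ((S.scale : ℂ) * T.trans) V = U := by
  simp [substFin]

theorem coe_substFin (F : Finset (Tile m)) :
    (S.substFin F : Set (Tile m)) = S.substSet F := by
  ext U
  simp [substFin, substSet, substTile]

theorem coe_patch (k : ℕ) (T : Tile m) :
    (S.patch k T : Set (Tile m)) = S.substSet^[k] {T} := by
  induction k with
  | zero => simp [patch]
  | succ k ih =>
    rw [patch] at ih ⊢
    rw [Function.iterate_succ_apply', Function.iterate_succ_apply', coe_substFin, ih]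

theorem coe_patch_eq_supertile (k : ℕ) (i : Fin m) :
    (S.patch k ⟨i, 1, 0⟩ : Set (Tile m)) = S.supertile k i :=
  S.coe_patch k _

theorem patch_zero (T : Tile m) : S.patch 0 T = {T} := rfl

theorem mem_iterate_substFin {k : ℕ} {F : Finset (Tile m)} {U : Tile m} :
    U ∈ S.substFin^[k] F ↔ ∃ T ∈ F, U ∈ S.patch k T := by
  induction k generalizing U with
  | zero => simp [patch]
  | succ k ih =>
    simp only [patch, Function.iterate_succ_apply', mem_substFin] at ih ⊢
    constructor
    · rintro ⟨T, hT, h⟩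
      obtain ⟨T', hT', hT2⟩ := ih.1 hT
      exact ⟨T', hT', T, hT2, h⟩
    · rintro ⟨T', hT', T, hT2, h⟩
      exact ⟨T, ih.2 ⟨T', hT', hT2⟩, h⟩

-- Substitution acts tile by tile. This splitting of a large supertile into smaller ones underlies
-- both the matrix product and the later cutting of patches.
open Classical in
theorem patch_add (a b : ℕ) (T : Tile m) :
    S.patch (a + b) T = (S.patch b T).biUnion (S.patch a) := by
  ext U
  rw [patch, Function.iterate_add_apply, mem_iterate_substFin, Finset.mem_biUnion]
  rfl

open Classical in
theorem substFin_image_move (R : Circle) (t : ℂ) (F : Finset (Tile m)) :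
    S.substFin (F.image (Tile.move R t)) =
      (S.substFin F).image (Tile.move R ((S.scale : ℂ) * t)) := by
  have key : ∀ T V : Tile m, Tile.move (Tile.move R t T).rot
      ((S.scale : ℂ) * (Tile.move R t T).trans) V =
      Tile.move R ((S.scale : ℂ) * t) (Tile.move T.rot ((S.scale : ℂ) * T.trans) V) := by
    intro T V
    rw [Tile.move_move]
    simp only [Tile.move]
    congr 2
    ring
  ext U
  simp only [mem_substFin, Finset.mem_image]
  constructor
  · rintro ⟨_, ⟨T, hT, rfl⟩, V, hV, rfl⟩
    exact ⟨_, ⟨T, hT, V, hV, rfl⟩, (key T V).symm⟩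
  · rintro ⟨_, ⟨T, hT, V, hV, rfl⟩, rfl⟩
    exact ⟨_, ⟨T, hT, rfl⟩, V, hV, key T V⟩

-- Real inflation commutes with rotations, so each substitution keeps the rotation of the motion and
-- only scales its translation by `λ`.
open Classical in
theorem patch_move (k : ℕ) (R : Circle) (t : ℂ) (T : Tile m) :
    S.patch k (Tile.move R t T) = (S.patch k T).image (Tile.move R ((S.scale : ℂ) ^ k * t)) := by
  induction k with
  | zero => simp [patch]
  | succ k ih =>
    rw [patch] at ih ⊢
    rw [Function.iterate_succ_apply', ih, substFin_image_move, patch, patch,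
      Function.iterate_succ_apply', pow_succ', mul_assoc]

open Classical in
theorem patch_eq_image (k : ℕ) (T : Tile m) :
    S.patch k T =
      (S.patch k ⟨T.idx, 1, 0⟩).image (Tile.move T.rot ((S.scale : ℂ) ^ k * T.trans)) := by
  conv_lhs => rw [T.eq_move]
  rw [patch_move]

/-- A congruent copy of a supertile is generated by a tile. -/
theorem move_image_supertile (k : ℕ) (i : Fin m) (R : Circle) (t : ℂ) :
    Tile.move R t '' S.supertile k i = (S.patch k ⟨i, R, t / (S.scale : ℂ) ^ k⟩ : Set (Tile m)) := by
  classical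
  rw [patch_eq_image, Finset.coe_image, coe_patch_eq_supertile,
    mul_div_cancel₀ _ (pow_ne_zero _ S.scale_ne_zero)]

theorem card_patch (k : ℕ) (T : Tile m) :
    (S.patch k T).card = (S.patch k ⟨T.idx, 1, 0⟩).card := by
  classical
  rw [patch_eq_image, Finset.card_image_of_injective _ (Tile.move_injective _ _)]

theorem interior_carrier (T : Tile m) :
    interior (T.carrier S.proto) =
      Tile.motion T.rot T.trans '' interior (S.proto T.idx) :=
  ((Tile.motion T.rot T.trans).toHomeomorph.image_interior _).symm

theorem closure_interior_carrier (T : Tile m) :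
    closure (interior (T.carrier S.proto)) = T.carrier S.proto := by
  rw [interior_carrier, Tile.carrier_eq_motion_image]
  conv_rhs => rw [← S.proto_regular]
  exact ((Tile.motion T.rot T.trans).toHomeomorph.image_closure _).symm

theorem interior_proto_nonempty (i : Fin m) : (interior (S.proto i)).Nonempty := by
  rw [← closure_nonempty_iff, S.proto_regular]
  exact S.proto_nonempty i

theorem interior_carrier_nonempty (T : Tile m) : (interior (T.carrier S.proto)).Nonempty := by
  rw [interior_carrier]
  exact (S.interior_proto_nonempty _).image _

theorem isCompact_carrier (T : Tile m) : IsCompact (T.carrier S.proto) :=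
  (S.proto_compact T.idx).image (Tile.motion T.rot T.trans).continuous

theorem biUnion_carrier_subst (T : Tile m) :
    ⋃ V ∈ S.subst T.idx, (Tile.move T.rot ((S.scale : ℂ) * T.trans) V).carrier S.proto =
      (fun z => (S.scale : ℂ) * z) '' T.carrier S.proto := by
  simp only [Tile.carrier_move, ← Set.image_iUnion, ← S.selfSimilar]
  rw [Tile.carrier, Set.image_image, Set.image_image]
  refine Set.image_congr fun z _ => ?_
  simp only [Tile.motion_apply]
  ring

/-- A supertile of order `k` covers the `λ^k`-fold inflation of its generating tile. -/
theorem biUnion_carrier_patch (k : ℕ) (T : Tile m) :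
    ⋃ U ∈ S.patch k T, U.carrier S.proto =
      (fun z => (S.scale : ℂ) ^ k * z) '' T.carrier S.proto := by
  induction k with
  | zero => simp [patch_zero]
  | succ k ih =>
    have h : ⋃ U ∈ S.patch (k + 1) T, U.carrier S.proto =
        ⋃ W ∈ S.patch k T, (fun z => (S.scale : ℂ) * z) '' W.carrier S.proto := by
      ext z
      simp only [patch, Function.iterate_succ_apply', Set.mem_iUnion, mem_substFin,
        ← biUnion_carrier_subst]
      constructor
      · rintro ⟨_, ⟨W, hW, V, hV, rfl⟩, hz⟩
        exact ⟨W, hW, V, hV, hz⟩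
      · rintro ⟨W, hW, V, hV, hz⟩
        exact ⟨_, ⟨W, hW, V, hV, rfl⟩, hz⟩
    simp only [h, ← Set.image_iUnion, ih, Set.image_image, pow_succ', mul_assoc]

theorem disjoint_interior_image_pow_scale {A B : Set ℂ} (k : ℕ)
    (h : Disjoint (interior A) (interior B)) :
    Disjoint (interior ((fun z => (S.scale : ℂ) ^ k * z) '' A))
      (interior ((fun z => (S.scale : ℂ) ^ k * z) '' B)) := by
  have hne := pow_ne_zero k S.scale_ne_zero
  have e : ∀ C : Set ℂ, interior ((fun z => (S.scale : ℂ) ^ k * z) '' C) =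
      (fun z => (S.scale : ℂ) ^ k * z) '' interior C :=
    fun C => ((Homeomorph.mulLeft₀ _ hne).image_interior C).symm
  rw [e, e, Set.disjoint_image_iff (mul_right_injective₀ hne)]
  exact h

theorem carrier_subset_of_mem_patch {k : ℕ} {T U : Tile m} (hU : U ∈ S.patch k T) :
    U.carrier S.proto ⊆ (fun z => (S.scale : ℂ) ^ k * z) '' T.carrier S.proto := by
  rw [← biUnion_carrier_patch]
  exact Set.subset_biUnion_of_mem (u := fun U : Tile m => U.carrier S.proto) hU

/-- Tiles in the supertiles of two non-overlapping tiles do not overlap. -/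
theorem disjoint_interior_of_mem_patch {k : ℕ} {T T' U U' : Tile m}
    (h : Disjoint (interior (T.carrier S.proto)) (interior (T'.carrier S.proto)))
    (hU : U ∈ S.patch k T) (hU' : U' ∈ S.patch k T') :
    Disjoint (interior (U.carrier S.proto)) (interior (U'.carrier S.proto)) :=
  (S.disjoint_interior_image_pow_scale k h).mono (interior_mono (S.carrier_subset_of_mem_patch hU))
    (interior_mono (S.carrier_subset_of_mem_patch hU'))

/-- A common tile would have empty interior. Thus non-overlap becomes disjointness of finite sets of
tiles, as needed to split sums. -/
theorem disjoint_patch {k : ℕ} {T T' : Tile m}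
    (h : Disjoint (interior (T.carrier S.proto)) (interior (T'.carrier S.proto))) :
    Disjoint (S.patch k T) (S.patch k T') := by
  rw [Finset.disjoint_left]
  intro U hU hU'
  have := S.disjoint_interior_of_mem_patch h hU hU'
  rw [disjoint_self] at this
  exact (S.interior_carrier_nonempty U).ne_empty this

theorem mem_patch_one {T U : Tile m} : U ∈ S.patch 1 T ↔
    ∃ V ∈ S.subst T.idx, Tile.move T.rot ((S.scale : ℂ) * T.trans) V = U := by
  rw [patch, Function.iterate_one, mem_substFin]
  simp

/-- Peeling off the last substitution, two tiles either have the same parent, where the defining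
property of `σ` applies, or different parents, whose inflations do not overlap by induction. -/
theorem nonOverlapping_patch (k : ℕ) (T : Tile m) :
    NonOverlapping S.proto (S.patch k T : Set (Tile m)) := by
  classical
  induction k with
  | zero => simp [patch_zero, NonOverlapping]
  | succ k ih =>
    intro U hU U' hU' hne
    rw [add_comm, patch_add, Finset.mem_coe, Finset.mem_biUnion] at hU hU'
    obtain ⟨W, hW, hUW⟩ := hU
    obtain ⟨W', hW', hUW'⟩ := hU'
    by_cases hWW : W = W'
    · subst hWW
      obtain ⟨V, hV, rfl⟩ := S.mem_patch_one.1 hUW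
      obtain ⟨V', hV', rfl⟩ := S.mem_patch_one.1 hUW'
      have hVV : V ≠ V' := fun h => hne (by rw [h])
      have hd := S.subst_nonOverlapping W.idx hV hV' hVV
      have e : ∀ V : Tile m, interior ((Tile.move W.rot ((S.scale : ℂ) * W.trans) V).carrier
          S.proto) = Tile.motion W.rot ((S.scale : ℂ) * W.trans) '' interior (V.carrier S.proto) :=
        fun V => by
          rw [Tile.carrier_move]
          exact ((Tile.motion _ _).toHomeomorph.image_interior _).symm
      change Disjoint (interior _) (interior _)
      rw [e, e, Set.disjoint_image_iff (Tile.motion _ _).injective]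
      exact hd
    · exact S.disjoint_interior_of_mem_patch (ih hW hW' hWW) hUW hUW'

theorem pairwiseDisjoint_patch (k l : ℕ) (T : Tile m) :
    (S.patch l T : Set (Tile m)).PairwiseDisjoint (S.patch k) :=
  fun _ hW _ hW' hne => S.disjoint_patch (S.nonOverlapping_patch l T hW hW' hne)

theorem sum_patch_add {β : Type*} [AddCommMonoid β] (a b : ℕ) (T : Tile m) (f : Tile m → β) :
    ∑ U ∈ S.patch (a + b) T, f U = ∑ W ∈ S.patch b T, ∑ U ∈ S.patch a W, f U := by
  classical
  rw [patch_add, Finset.sum_biUnion (S.pairwiseDisjoint_patch a b T)]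

/-! ### Weyl matrices and their geometric decay relative to tile counts. -/

open Classical in
/-- The matrix of Weyl sums: the `n`-th powers of the rotations of the tiles of type `i` in the
supertile of order `k` and type `j`. -/
def weylMatrix (n k : ℕ) : Matrix (Fin m) (Fin m) ℂ :=
  Matrix.of fun i j => ∑ U ∈ S.patch k ⟨j, 1, 0⟩, if U.idx = i then (U.rot : ℂ) ^ n else 0

open Classical in
/-- The number of tiles of type `i` in the supertile of order `k` and type `j`. -/
def countMatrix (k : ℕ) : Matrix (Fin m) (Fin m) ℕ :=
  Matrix.of fun i j => ((S.patch k ⟨j, 1, 0⟩).filter fun U => U.idx = i).card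

/-- Rotating a supertile multiplies its Weyl sum by the `n`-th power of the rotation, and
translations have no effect; hence only the type of the generating tile matters. -/
theorem sum_patch_ite_idx (n k : ℕ) (i : Fin m) (T : Tile m) :
    ∑ U ∈ S.patch k T, (if U.idx = i then (U.rot : ℂ) ^ n else 0) =
      (T.rot : ℂ) ^ n * S.weylMatrix n k i T.idx := by
  classical
  rw [patch_eq_image, Finset.sum_image (Tile.move_injective _ _).injOn, weylMatrix,
    Matrix.of_apply, Finset.mul_sum]
  refine Finset.sum_congr rfl fun U _ => ?_
  by_cases h : U.idx = i <;> simp [Tile.move, h, mul_pow]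

theorem weylMatrix_add (n a b : ℕ) :
    S.weylMatrix n (a + b) = S.weylMatrix n a * S.weylMatrix n b := by
  classical
  ext i j
  rw [Matrix.mul_apply, weylMatrix, Matrix.of_apply, sum_patch_add]
  simp only [sum_patch_ite_idx]
  rw [← Finset.sum_fiberwise_of_maps_to (g := Tile.idx) (t := Finset.univ)
    (fun _ _ => Finset.mem_univ _)]
  refine Finset.sum_congr rfl fun l _ => ?_
  rw [weylMatrix, weylMatrix, Matrix.of_apply, Matrix.of_apply, Finset.mul_sum, Finset.sum_filter]
  refine Finset.sum_congr rfl fun T _ => ?_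
  by_cases h : T.idx = l <;> simp [h, mul_comm]

theorem weylMatrix_zero_left (k : ℕ) :
    S.weylMatrix 0 k = (S.countMatrix k).map (Nat.cast : ℕ → ℂ) := by
  ext i j
  simp [weylMatrix, countMatrix]

/-- This is the case `n = 0` of the multiplicativity of Weyl matrices. -/
theorem countMatrix_add (a b : ℕ) :
    S.countMatrix (a + b) = S.countMatrix a * S.countMatrix b := by
  have h := S.weylMatrix_add 0 a b
  simp only [weylMatrix_zero_left] at h
  ext i j
  have hij := congrFun (congrFun h i) j
  simp only [Matrix.map_apply, Matrix.mul_apply] at hij ⊢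
  exact_mod_cast hij

theorem countMatrix_eq_pow (k : ℕ) : S.countMatrix k = S.substMatrix ^ k := by
  classical
  induction k with
  | zero =>
    ext i j
    rw [countMatrix, Matrix.of_apply, patch_zero, pow_zero, Matrix.one_apply,
      Finset.filter_singleton]
    by_cases h : j = i
    · simp [h]
    · simp [h, Ne.symm h]
  | succ k ih =>
    rw [countMatrix_add, pow_succ, ih]
    congr 1
    ext i j
    have : S.patch 1 ⟨j, 1, 0⟩ = S.subst j := by
      ext U
      rw [mem_patch_one]
      simp [Tile.move_one_zero]
    rw [countMatrix, Matrix.of_apply, this, substMatrix, Matrix.of_apply]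

theorem norm_weylMatrix_le (n k : ℕ) (i j : Fin m) :
    ‖S.weylMatrix n k i j‖ ≤ S.countMatrix k i j := by
  classical
  rw [weylMatrix, countMatrix, Matrix.of_apply, Matrix.of_apply, ← Finset.sum_filter]
  refine (norm_sum_le_of_le (n := fun _ => (1 : ℝ)) _ fun U _ => ?_).trans (by simp)
  rw [norm_pow, Circle.norm_coe, one_pow]

/-- If a sum of unit vectors has maximal norm, then all the summands agree. -/
theorem _root_.eq_of_card_le_norm_sum {ι : Type*} {s : Finset ι} {u : ι → ℂ}
    (hu : ∀ i ∈ s, ‖u i‖ = 1) (h : (s.card : ℝ) ≤ ‖∑ i ∈ s, u i‖) {a b : ι} (ha : a ∈ s)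
    (hb : b ∈ s) : u a = u b := by
  classical
  by_contra hne
  have hab : b ≠ a := fun h => hne (by rw [h])
  have hb' : b ∈ s.erase a := Finset.mem_erase.2 ⟨hab, hb⟩
  -- Two distinct unit vectors have a sum of norm less than `2`, a loss the other summands cannot
  -- make up.
  have hpar := parallelogram_law_with_norm ℝ (u a) (u b)
  rw [hu a ha, hu b hb] at hpar
  have hpos : 0 < ‖u a - u b‖ := norm_pos_iff.2 (sub_ne_zero.2 hne)
  have hlt : ‖u a + u b‖ < 2 := by nlinarith [norm_nonneg (u a + u b)]
  have hrest : ‖∑ i ∈ (s.erase a).erase b, u i‖ ≤ ((s.erase a).erase b).card := by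
    refine (norm_sum_le_of_le (n := fun _ => (1 : ℝ)) _ fun i hi => ?_).trans (by simp)
    exact (hu i (Finset.mem_of_mem_erase (Finset.mem_of_mem_erase hi))).le
  have hcard : (s.card : ℝ) = ((s.erase a).erase b).card + 2 := by
    rw [← Finset.card_erase_add_one ha, ← Finset.card_erase_add_one hb']
    push_cast; ring
  rw [← Finset.add_sum_erase _ _ ha, ← Finset.add_sum_erase _ _ hb', ← add_assoc] at h
  have := norm_add_le (u a + u b) (∑ i ∈ (s.erase a).erase b, u i)
  linarith

/-- Infinitely many orientations force cancellation in some Weyl sum of a supertile. -/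
theorem exists_norm_weylMatrix_lt {X : Set (Tile m)} (hX : S.IsSubstitutionTiling X)
    (hinf : ∃ i : Fin m, {α : ℝ | ∃ T ∈ X, T.idx = i ∧ T.orientation = α}.Infinite)
    {n : ℕ} (hn : 0 < n) :
    ∃ k i j, ‖S.weylMatrix n k i j‖ < S.countMatrix k i j := by
  classical
  by_contra! hge
  obtain ⟨i, hi⟩ := hinf
  -- A single supertile contains copies of both tiles under a common motion, whose rotation then
  -- cancels.
  have hconst : ∀ T ∈ X, ∀ T' ∈ X, T.idx = i → T'.idx = i →
      (T.rot : ℂ) ^ n = (T'.rot : ℂ) ^ n := by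
    intro T hT T' hT' hTi hTi'
    obtain ⟨j, k, R, t, hsub⟩ := hX.2 {T, T'} (by
      rintro U (rfl | rfl) <;> assumption) (by simp)
    rw [← coe_patch_eq_supertile] at hsub
    have h1 : Tile.move R t T ∈ S.patch k ⟨j, 1, 0⟩ := hsub ⟨T, by simp, rfl⟩
    have h2 : Tile.move R t T' ∈ S.patch k ⟨j, 1, 0⟩ := hsub ⟨T', by simp, rfl⟩
    have h3 := hge k i j
    rw [weylMatrix, countMatrix, Matrix.of_apply, Matrix.of_apply, ← Finset.sum_filter] at h3
    have h4 := eq_of_card_le_norm_sum (fun U _ => by rw [norm_pow, Circle.norm_coe, one_pow]) h3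
      (Finset.mem_filter.2 ⟨h1, hTi⟩) (Finset.mem_filter.2 ⟨h2, hTi'⟩)
    simp only [Tile.move, Circle.coe_mul, mul_pow] at h4
    exact mul_left_cancel₀ (pow_ne_zero _ R.coe_ne_zero) h4
  obtain ⟨_, T₀, hT₀, hi₀, -⟩ := hi.nonempty
  -- All rotations of type-`i` tiles are `n`-th roots of one fixed number.
  refine hi (Set.Finite.subset (((Polynomial.nthRoots n ((T₀.rot : ℂ) ^ n)).toFinset.finite_toSet).image
    (fun z => toIcoMod Real.two_pi_pos 0 (Complex.arg z))) ?_)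
  rintro _ ⟨T, hT, hTi, rfl⟩
  refine ⟨T.rot, ?_, rfl⟩
  rw [Finset.mem_coe, Multiset.mem_toFinset, Polynomial.mem_nthRoots hn]
  exact hconst T hT T₀ hT₀ hTi hi₀

/-- One strict summand suffices in a matrix product if its other factor has positive count. With the
mirrored version below, a strict entry spreads to its column and then to the whole matrix. -/
theorem norm_weylMatrix_add_lt_left {n a b : ℕ} {i l j : Fin m} (ha : 0 < S.countMatrix a i l)
    (hb : ‖S.weylMatrix n b l j‖ < S.countMatrix b l j) :
    ‖S.weylMatrix n (a + b) i j‖ < S.countMatrix (a + b) i j := by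
  rw [weylMatrix_add, countMatrix_add, Matrix.mul_apply, Matrix.mul_apply]
  push_cast
  refine (norm_sum_le _ _).trans_lt (Finset.sum_lt_sum (fun p _ => ?_) ⟨l, Finset.mem_univ l, ?_⟩)
  · rw [norm_mul]
    exact mul_le_mul (S.norm_weylMatrix_le n a i p) (S.norm_weylMatrix_le n b p j) (norm_nonneg _)
      (Nat.cast_nonneg _)
  · rw [norm_mul]
    exact mul_lt_mul' (S.norm_weylMatrix_le n a i l) hb (norm_nonneg _) (Nat.cast_pos.2 ha)

theorem norm_weylMatrix_add_lt_right {n a b : ℕ} {i l j : Fin m} (ha : 0 < S.countMatrix a l j)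
    (hb : ‖S.weylMatrix n b i l‖ < S.countMatrix b i l) :
    ‖S.weylMatrix n (b + a) i j‖ < S.countMatrix (b + a) i j := by
  rw [weylMatrix_add, countMatrix_add, Matrix.mul_apply, Matrix.mul_apply]
  push_cast
  refine (norm_sum_le _ _).trans_lt (Finset.sum_lt_sum (fun p _ => ?_) ⟨l, Finset.mem_univ l, ?_⟩)
  · rw [norm_mul]
    exact mul_le_mul (S.norm_weylMatrix_le n b i p) (S.norm_weylMatrix_le n a p j) (norm_nonneg _)
      (Nat.cast_nonneg _)
  · rw [norm_mul]
    exact (mul_le_mul_of_nonneg_left (S.norm_weylMatrix_le n a l j) (norm_nonneg _)).trans_lt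
      (mul_lt_mul_of_pos_right hb (Nat.cast_pos.2 ha))

/-- The Weyl sums of supertiles are negligible, uniformly in the supertiles of order `k → ∞`. -/
theorem exists_tendsto_norm_sum_patch_le (hS : S.IsPrimitive) {X : Set (Tile m)}
    (hX : S.IsSubstitutionTiling X)
    (hinf : ∃ i : Fin m, {α : ℝ | ∃ T ∈ X, T.idx = i ∧ T.orientation = α}.Infinite)
    {n : ℕ} (hn : 0 < n) :
    ∃ ε : ℕ → ℝ, Tendsto ε atTop (𝓝 0) ∧ (∀ k, 0 ≤ ε k) ∧ ∀ k T,
      ‖∑ U ∈ S.patch k T, (U.rot : ℂ) ^ n‖ ≤ ε k * (S.patch k T).card := by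
  classical
  obtain ⟨k, i₀, j₀, hlt⟩ := S.exists_norm_weylMatrix_lt hX hinf hn
  obtain ⟨k₀, hk₀, hpos⟩ := hS
  simp only [← countMatrix_eq_pow] at hpos
  -- The order-`k` matrix with its strict entry is sandwiched between two strictly positive matrices
  -- of order `k₀`.
  obtain ⟨K, hK, hKlt⟩ : ∃ K, 1 ≤ K ∧ ∀ i j, ‖S.weylMatrix n K i j‖ < S.countMatrix K i j :=
    ⟨k₀ + (k + k₀), by omega, fun i j => S.norm_weylMatrix_add_lt_left (hpos i i₀)
      (S.norm_weylMatrix_add_lt_right (hpos j₀ j) hlt)⟩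
  have : Nonempty (Fin m × Fin m) := ⟨(i₀, j₀)⟩
  obtain ⟨p, hp⟩ := Finite.exists_max fun p : Fin m × Fin m =>
    ‖S.weylMatrix n K p.1 p.2‖ / S.countMatrix K p.1 p.2
  set δ := ‖S.weylMatrix n K p.1 p.2‖ / S.countMatrix K p.1 p.2
  have hcpos : ∀ i j, (0 : ℝ) < S.countMatrix K i j := fun i j =>
    (norm_nonneg _).trans_lt (hKlt i j)
  have hδ0 : 0 ≤ δ := by positivity
  have hδ1 : δ < 1 := (div_lt_one (hcpos _ _)).2 (hKlt _ _)
  have hδ : ∀ i j, ‖S.weylMatrix n K i j‖ ≤ δ * S.countMatrix K i j := fun i j =>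
    (div_le_iff₀ (hcpos i j)).1 (hp (i, j))
  have hdecay : ∀ r s i j, ‖S.weylMatrix n (K * r + s) i j‖ ≤
      δ ^ r * S.countMatrix (K * r + s) i j := by
    intro r s
    induction r with
    | zero => intro i j; simpa using S.norm_weylMatrix_le n s i j
    | succ r ih =>
      intro i j
      have e : K * (r + 1) + s = K + (K * r + s) := by ring
      rw [e, weylMatrix_add, countMatrix_add, Matrix.mul_apply, Matrix.mul_apply]
      push_cast
      rw [Finset.mul_sum]
      refine norm_sum_le_of_le _ fun l _ => ?_
      rw [norm_mul]
      calc _ ≤ (δ * S.countMatrix K i l) * (δ ^ r * S.countMatrix (K * r + s) l j) :=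
            mul_le_mul (hδ i l) (ih l j) (norm_nonneg _) (by positivity)
        _ = _ := by ring
  -- Only complete blocks of `K` substitutions gain a factor `δ`; the remainder is bounded
  -- trivially.
  refine ⟨fun k => δ ^ (k / K), ?_, fun k => by positivity, fun k T => ?_⟩
  · refine (tendsto_pow_atTop_nhds_zero_of_lt_one hδ0 hδ1).comp ?_
    exact Nat.tendsto_div_const_atTop (by omega)
  · have hsum : ∑ U ∈ S.patch k T, (U.rot : ℂ) ^ n =
        (T.rot : ℂ) ^ n * ∑ i, S.weylMatrix n k i T.idx := by
      rw [Finset.mul_sum]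
      simp only [← sum_patch_ite_idx]
      rw [Finset.sum_comm]
      simp
    have hcard : ((S.patch k T).card : ℝ) = ∑ i, (S.countMatrix k i T.idx : ℝ) := by
      rw [card_patch, Finset.card_eq_sum_card_fiberwise (f := Tile.idx) (t := Finset.univ)
        (fun _ _ => Finset.mem_coe.2 (Finset.mem_univ _))]
      push_cast
      rfl
    rw [hsum, hcard, norm_mul, norm_pow, Circle.norm_coe, one_pow, one_mul, Finset.mul_sum]
    refine norm_sum_le_of_le _ fun i _ => ?_
    have := hdecay (k / K) (k % K) i T.idx
    rwa [Nat.div_add_mod] at this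

/-- The supertiles of order less than `k` have boundedly many tiles. -/
theorem exists_card_patch_le (k : ℕ) : ∃ B, ∀ l < k, ∀ T, (S.patch l T).card ≤ B := by
  refine ⟨∑ l ∈ Finset.range k, ∑ i, (S.patch l ⟨i, 1, 0⟩).card, fun l hl T => ?_⟩
  rw [card_patch]
  exact (Finset.single_le_sum (f := fun i => (S.patch l ⟨i, 1, 0⟩).card)
    (fun _ _ => Nat.zero_le _) (Finset.mem_univ T.idx)).trans
    (Finset.single_le_sum (f := fun l => ∑ i, (S.patch l ⟨i, 1, 0⟩).card)
    (fun _ _ => Nat.zero_le _) (Finset.mem_range.2 hl))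

end TileSubstitution

/-! ### Area bounds and the boundary estimate for disc-like patches. -/

namespace Tile

open MeasureTheory in
theorem volume_real_motion_image (R : Circle) (t : ℂ) (A : Set ℂ) :
    volume.real (motion R t '' A) = volume.real A := by
  have h : MeasurePreserving (motion R t).symm volume volume := by
    have h1 : MeasurePreserving (motion R t) volume volume :=
      (measurePreserving_add_right volume t).comp (rotation R).measurePreserving
    exact h1.symm (motion R t).toHomeomorph.toMeasurableEquiv
  have h2 := h.measure_preimage_emb
    (motion R t).symm.toHomeomorph.measurableEmbedding A
  rw [Measure.real, Measure.real, ← h2, (motion R t).preimage_symm]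

end Tile

namespace TileSubstitution

variable {m : ℕ} (S : TileSubstitution m)

-- There are finitely many prototiles, and motions preserve area. Arguing with eventual bounds
-- avoids a separate case for `m = 0`.
open MeasureTheory in
theorem exists_le_volume_interior_carrier :
    ∃ a : ℝ, 0 < a ∧ ∀ T : Tile m, a ≤ volume.real (interior (T.carrier S.proto)) := by
  have h : ∀ᶠ a : ℝ in 𝓝[>] 0, ∀ i, a ≤ volume.real (interior (S.proto i)) := by
    refine eventually_all.2 fun i => ?_
    have hpos : 0 < volume.real (interior (S.proto i)) := by
      refine ENNReal.toReal_pos (isOpen_interior.measure_pos _ (S.interior_proto_nonempty i)).ne' ?_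
      exact ((measure_mono interior_subset).trans_lt (S.proto_compact i).measure_lt_top).ne
    exact eventually_nhdsWithin_of_eventually_nhds (eventually_le_nhds hpos)
  obtain ⟨a, ha, hpos⟩ := (h.and self_mem_nhdsWithin).exists
  refine ⟨a, hpos, fun T => ?_⟩
  rw [interior_carrier, Tile.volume_real_motion_image]
  exact ha T.idx

open MeasureTheory in
theorem exists_volume_carrier_le :
    ∃ A : ℝ, 0 < A ∧ ∀ T : Tile m, volume.real (T.carrier S.proto) ≤ A := by
  have h : ∀ᶠ A : ℝ in atTop, ∀ i, volume.real (S.proto i) ≤ A :=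
    eventually_all.2 fun i => eventually_ge_atTop _
  obtain ⟨A, hA, hpos⟩ := (h.and (eventually_gt_atTop 0)).exists
  refine ⟨A, hpos, fun T => ?_⟩
  rw [Tile.carrier_eq_motion_image, Tile.volume_real_motion_image]
  exact hA T.idx

theorem exists_dist_carrier_le :
    ∃ D : ℝ, 0 < D ∧ ∀ T : Tile m, ∀ z ∈ T.carrier S.proto, ∀ w ∈ T.carrier S.proto,
      dist z w ≤ D := by
  have h : ∀ᶠ D : ℝ in atTop, ∀ i, Metric.diam (S.proto i) ≤ D :=
    eventually_all.2 fun i => eventually_ge_atTop _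
  obtain ⟨D, hD, hpos⟩ := (h.and (eventually_gt_atTop 0)).exists
  refine ⟨D, hpos, fun T z hz w hw => ?_⟩
  refine (Metric.dist_le_diam_of_mem (S.isCompact_carrier T).isBounded hz hw).trans ?_
  rw [Tile.carrier_eq_motion_image, (Tile.motion T.rot T.trans).isometry.diam_image]
  exact hD T.idx

open MeasureTheory in
/-- A bounded region contains few non-overlapping tiles. -/
theorem mul_card_le_volume {a : ℝ}
    (ha : ∀ T : Tile m, a ≤ volume.real (interior (T.carrier S.proto))) {F : Finset (Tile m)}
    (hF : NonOverlapping S.proto (F : Set (Tile m))) {B : Set ℂ} (hB : Bornology.IsBounded B)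
    (h : ∀ T ∈ F, T.carrier S.proto ⊆ B) : a * F.card ≤ volume.real B := by
  have hfin : ∀ C ⊆ B, volume C ≠ ⊤ := fun C hC => (hB.subset hC).measure_lt_top.ne
  calc a * F.card = ∑ _T ∈ F, a := by rw [Finset.sum_const, nsmul_eq_mul, mul_comm]
    _ ≤ ∑ T ∈ F, volume.real (interior (T.carrier S.proto)) := Finset.sum_le_sum fun T _ => ha T
    _ = volume.real (⋃ T ∈ F, interior (T.carrier S.proto)) :=
      (measureReal_biUnion_finset hF (fun T _ => isOpen_interior.measurableSet)
        (fun T hT => hfin _ (interior_subset.trans (h T hT)))).symm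
    _ ≤ volume.real B := measureReal_mono
      (Set.iUnion₂_subset fun T hT => interior_subset.trans (h T hT)) (hfin B subset_rfl)

open MeasureTheory in
/-- Covering a region requires many tiles. -/
theorem volume_le_mul_card {A : ℝ} (hA : ∀ T : Tile m, volume.real (T.carrier S.proto) ≤ A)
    {F : Finset (Tile m)} {B : Set ℂ} (h : B ⊆ ⋃ T ∈ F, T.carrier S.proto) :
    volume.real B ≤ A * F.card := by
  have hc : IsCompact (⋃ T ∈ F, T.carrier S.proto) :=
    F.isCompact_biUnion fun T _ => S.isCompact_carrier T
  calc volume.real B ≤ volume.real (⋃ T ∈ F, T.carrier S.proto) :=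
        measureReal_mono h hc.measure_lt_top.ne
    _ ≤ ∑ T ∈ F, volume.real (T.carrier S.proto) := measureReal_biUnion_finset_le _ _
    _ ≤ ∑ _T ∈ F, A := Finset.sum_le_sum fun T _ => hA T
    _ = A * F.card := by rw [Finset.sum_const, nsmul_eq_mul, mul_comm]

open MeasureTheory in
theorem _root_.Complex.volume_real_closedBall (p : ℂ) {r : ℝ} (hr : 0 ≤ r) :
    volume.real (Metric.closedBall p r) = Real.pi * r ^ 2 := by
  rw [Measure.real, Complex.volume_closedBall, ENNReal.toReal_mul, ENNReal.toReal_pow,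
    ENNReal.toReal_ofReal hr, mul_comm]
  rfl

open MeasureTheory in
theorem _root_.Complex.volume_real_ball (p : ℂ) {r : ℝ} (hr : 0 ≤ r) :
    volume.real (Metric.ball p r) = Real.pi * r ^ 2 := by
  rw [Measure.real, Complex.volume_ball, ENNReal.toReal_mul, ENNReal.toReal_pow,
    ENNReal.toReal_ofReal hr, mul_comm]
  rfl

/-- The Weyl sum over a patch differs from the sum over the supertiles of order `k` it contains by
at most the number of tiles lying in supertiles that are not contained in the patch. -/
theorem norm_sum_le_of_subset_patch {n k K : ℕ} {ε : ℝ} (hε : 0 ≤ ε)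
    (hk : ∀ T, ‖∑ U ∈ S.patch k T, (U.rot : ℂ) ^ n‖ ≤ ε * (S.patch k T).card) (hkK : k ≤ K)
    {T₀ : Tile m} {F : Finset (Tile m)} (hF : F ⊆ S.patch K T₀) {b : ℝ}
    (hb : ∀ G ⊆ F, (∀ T ∈ G, ∃ Q, T ∈ S.patch k Q ∧ S.patch k Q ⊆ S.patch K T₀ ∧
      ¬ S.patch k Q ⊆ F) → (G.card : ℝ) ≤ b) :
    ‖∑ T ∈ F, (T.rot : ℂ) ^ n‖ ≤ ε * F.card + b := by
  classical
  obtain ⟨l, rfl⟩ := Nat.exists_eq_add_of_le hkK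
  -- These generate the order-`k` supertiles lying wholly in `F`. Every remaining tile of `F` is in
  -- a supertile that leaves `F`, and is counted by `b`.
  let full := (S.patch l T₀).filter fun Q => S.patch k Q ⊆ F
  let good := full.biUnion (S.patch k)
  have hdisj : (full : Set (Tile m)).PairwiseDisjoint (S.patch k) :=
    (S.pairwiseDisjoint_patch k l T₀).subset (Finset.coe_subset.2 (Finset.filter_subset _ _))
  have hgood : good ⊆ F := Finset.biUnion_subset.2 fun Q hQ => (Finset.mem_filter.1 hQ).2
  have h1 : ‖∑ T ∈ good, (T.rot : ℂ) ^ n‖ ≤ ε * F.card := by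
    rw [Finset.sum_biUnion hdisj]
    refine (norm_sum_le_of_le _ fun Q _ => hk Q).trans ?_
    rw [← Finset.mul_sum, ← Nat.cast_sum, ← Finset.card_biUnion hdisj]
    have := Finset.card_le_card hgood
    gcongr
  have h2 : ‖∑ T ∈ F \ good, (T.rot : ℂ) ^ n‖ ≤ b := by
    refine le_trans ?_ (hb (F \ good) Finset.sdiff_subset fun T hT => ?_)
    · refine (norm_sum_le_of_le (n := fun _ => (1 : ℝ)) _ fun U _ => ?_).trans (by simp)
      rw [norm_pow, Circle.norm_coe, one_pow]
    · rw [Finset.mem_sdiff] at hT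
      have hTK := hF hT.1
      rw [patch_add, Finset.mem_biUnion] at hTK
      obtain ⟨Q, hQ, hTQ⟩ := hTK
      refine ⟨Q, hTQ, ?_, fun hsub => hT.2 ?_⟩
      · rw [patch_add]
        exact Finset.subset_biUnion_of_mem _ hQ
      · exact Finset.mem_biUnion.2 ⟨Q, Finset.mem_filter.2 ⟨hQ, hsub⟩, hTQ⟩
  rw [← Finset.sum_sdiff hgood]
  refine (norm_add_le _ _).trans ?_
  linarith

/-- A tile of a patch that does not belong to a sub-patch covering a ball has a point outside
this ball. -/
theorem exists_mem_carrier_not_mem_ball {G : Set (Tile m)} (hG : NonOverlapping S.proto G)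
    {F : Finset (Tile m)} (hF : (F : Set (Tile m)) ⊆ G) {p : ℂ} {r : ℝ}
    (hball : Metric.ball p r ⊆ ⋃ T ∈ F, T.carrier S.proto) {T : Tile m} (hT : T ∈ G)
    (hTF : T ∉ F) : ∃ w ∈ T.carrier S.proto, r ≤ dist w p := by
  obtain ⟨w, hw⟩ := S.interior_carrier_nonempty T
  refine ⟨w, interior_subset hw, ?_⟩
  by_contra! hlt
  obtain ⟨U, hU, hwU⟩ := Set.mem_iUnion₂.1 (hball (Metric.mem_ball.2 hlt))
  have hd : Disjoint (interior (T.carrier S.proto)) (interior (U.carrier S.proto)) :=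
    hG hT (hF hU) fun h => hTF (h ▸ hU)
  -- An open set disjoint from the interior of a tile misses its closure, which is the whole tile by
  -- regularity.
  have hd' := hd.closure_right isOpen_interior
  rw [closure_interior_carrier] at hd'
  exact Set.disjoint_left.1 hd' hw hwU

open MeasureTheory in
/-- Weyl sums over large disc-like patches are controlled by those over supertiles of order `k`,
up to a boundary term that is linear in the radius. -/
theorem exists_norm_sum_le_of_ball (k : ℕ) : ∃ c : ℝ, 0 ≤ c ∧
    ∀ (n K : ℕ) (ε : ℝ) (T₀ : Tile m) (F : Finset (Tile m)) (p : ℂ) (r : ℝ), 0 ≤ ε →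
      (∀ T, ‖∑ U ∈ S.patch k T, (U.rot : ℂ) ^ n‖ ≤ ε * (S.patch k T).card) → k ≤ K →
      F ⊆ S.patch K T₀ → Metric.ball p r ⊆ ⋃ T ∈ F, T.carrier S.proto →
      (∀ T ∈ F, ∃ z ∈ T.carrier S.proto, dist z p ≤ r) → c ≤ r →
      ‖∑ T ∈ F, (T.rot : ℂ) ^ n‖ ≤ ε * F.card + c * r := by
  obtain ⟨a, ha0, ha⟩ := S.exists_le_volume_interior_carrier
  obtain ⟨D, hD0, hD⟩ := S.exists_dist_carrier_le
  set D' := S.scale ^ k * D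
  have hDD' : D ≤ D' := le_mul_of_one_le_left hD0.le (one_le_pow₀ S.one_lt_scale.le)
  have hD'0 : 0 < D' := hD0.trans_le hDD'
  -- The annulus of radii `r ± D'` has area `4πD'r`, and each tile uses at least `a` of it. The
  -- maximum with `D'` makes the inner radius nonnegative.
  refine ⟨max D' (4 * Real.pi * D' / a), hD'0.le.trans (le_max_left _ _), ?_⟩
  intro n K ε T₀ F p r hε hk hkK hF hball hnear hr
  have hrD : D' ≤ r := (le_max_left _ _).trans hr
  have hr0 : 0 ≤ r := hD'0.le.trans hrD
  refine S.norm_sum_le_of_subset_patch hε hk hkK hF fun G hGF hG => ?_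
  -- `D'` bounds the diameter of an order-`k` supertile. A cut one has a point at distance at least
  -- `r` from `p`, so its tiles cannot be deep inside; as tiles of `F` they cannot be far outside
  -- either.
  have hsub : ∀ T ∈ G, T.carrier S.proto ⊆
      Metric.closedBall p (r + D') \ Metric.ball p (r - D') := by
    intro T hT z hz
    obtain ⟨Q, hTQ, hQK, hQF⟩ := hG T hT
    obtain ⟨T', hT'Q, hT'F⟩ := Finset.not_subset.1 hQF
    obtain ⟨w, hw, hwr⟩ := S.exists_mem_carrier_not_mem_ball (S.nonOverlapping_patch K T₀)
      (Finset.coe_subset.2 hF) hball (Finset.mem_coe.2 (hQK hT'Q)) hT'F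
    obtain ⟨u, hu, hur⟩ := hnear T (hGF hT)
    have hzu := hD T z hz u hu
    have hzw : dist z w ≤ D' := by
      obtain ⟨z', hz', rfl⟩ := S.carrier_subset_of_mem_patch hTQ hz
      obtain ⟨w', hw', rfl⟩ := S.carrier_subset_of_mem_patch hT'Q hw
      have := hD Q z' hz' w' hw'
      rw [dist_eq_norm] at this ⊢
      rw [← mul_sub, norm_mul, norm_pow, Complex.norm_real, Real.norm_eq_abs,
        abs_of_pos S.scale_pos]
      have := pow_pos S.scale_pos k
      exact mul_le_mul_of_nonneg_left ‹_› this.le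
    refine ⟨Metric.mem_closedBall.2 ?_, fun hzb => ?_⟩
    · have := dist_triangle z u p
      linarith
    · have h1 := Metric.mem_ball.1 hzb
      have h2 := dist_triangle w z p
      rw [dist_comm w z] at h2
      linarith
  have hno : NonOverlapping S.proto (G : Set (Tile m)) :=
    (S.nonOverlapping_patch K T₀).subset (Finset.coe_subset.2 (hGF.trans hF))
  have hvol := S.mul_card_le_volume ha hno
    (Metric.isBounded_closedBall.subset Set.sdiff_subset) hsub
  have hincl : Metric.ball p (r - D') ⊆ Metric.closedBall p (r + D') :=
    Metric.ball_subset_closedBall.trans (Metric.closedBall_subset_closedBall (by linarith))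
  rw [measureReal_sdiff hincl measurableSet_ball measure_closedBall_lt_top.ne,
    Complex.volume_real_closedBall p (by linarith), Complex.volume_real_ball p (by linarith)] at hvol
  have h1 : (G.card : ℝ) ≤ 4 * Real.pi * D' / a * r := by
    rw [div_mul_eq_mul_div, le_div_iff₀ ha0]
    linarith
  exact h1.trans (mul_le_mul_of_nonneg_right (le_max_right _ _) hr0)

end TileSubstitution

/-! ### Weyl averages along supertile lengths and by distance. -/

namespace TileSubstitution

variable {m : ℕ} (S : TileSubstitution m)

/-- The Weyl averages tend to zero along the supertile lengths of a numbering. -/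
theorem tendsto_weyl_average_supertilePrefix (hS : S.IsPrimitive) {X : Set (Tile m)}
    (hX : S.IsSubstitutionTiling X)
    (hinf : ∃ i : Fin m, {α : ℝ | ∃ T ∈ X, T.idx = i ∧ T.orientation = α}.Infinite)
    {e : ℕ → Tile m} (he : Function.Injective e) {n : ℕ} (hn : 0 < n) :
    Tendsto (fun N : ℕ => ‖∑ j ∈ Finset.range N, ((e j).rot : ℂ) ^ n‖ / N)
      (atTop ⊓ 𝓟 {l : ℕ | S.IsSupertilePrefix e l}) (𝓝 0) := by
  classical
  obtain ⟨ε, hε, -, hsum⟩ := S.exists_tendsto_norm_sum_patch_le hS hX hinf hn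
  rw [Metric.tendsto_nhds]
  intro η hη
  obtain ⟨k₀, hk₀⟩ := eventually_atTop.1 (hε.eventually (gt_mem_nhds hη))
  -- Supertiles of order below `k₀` have at most `B` tiles, so a longer prefix has order at least
  -- `k₀`.
  obtain ⟨B, hB⟩ := S.exists_card_patch_le k₀
  rw [eventually_inf_principal]
  filter_upwards [eventually_gt_atTop B] with N hN hpre
  obtain ⟨k, i, R, t, -, himg⟩ := hpre
  rw [move_image_supertile] at himg
  set T₀ : Tile m := ⟨i, R, t / (S.scale : ℂ) ^ k⟩
  have hFin : (Finset.range N).image e = S.patch k T₀ := by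
    rw [← Finset.coe_inj, ← himg, Finset.coe_image, Finset.coe_range]
  have hcard : (S.patch k T₀).card = N := by
    rw [← hFin, Finset.card_image_of_injective _ he, Finset.card_range]
  have hk : k₀ ≤ k := by
    by_contra! hlt
    have := hB k hlt T₀
    omega
  have hNpos : (0 : ℝ) < N := Nat.cast_pos.2 (by omega)
  have h := hsum k T₀
  rw [hcard, ← hFin, Finset.sum_image he.injOn] at h
  rw [Real.dist_eq, sub_zero, abs_of_nonneg (by positivity)]
  exact ((div_le_iff₀ hNpos).2 h).trans_lt (hk₀ k hk)

/-- A finite patch of a substitution tiling lies in a congruent copy of a supertile. -/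
theorem IsSubstitutionTiling.exists_subset_patch {S : TileSubstitution m} {X : Set (Tile m)}
    (hX : S.IsSubstitutionTiling X) {F : Finset (Tile m)} (hF : (F : Set (Tile m)) ⊆ X) :
    ∃ K T₀, F ⊆ S.patch K T₀ := by
  obtain ⟨i, K, R, t, hsub⟩ := hX.2 F hF F.finite_toSet
  -- This generates the supertile moved by the inverse motion; the division undoes the scaling of
  -- translations by `K` substitutions.
  refine ⟨K, ⟨i, R⁻¹, -((R⁻¹ : Circle) * t) / (S.scale : ℂ) ^ K⟩, ?_⟩
  rw [← Finset.coe_subset, ← move_image_supertile]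
  intro T hT
  refine ⟨Tile.move R t T, hsub ⟨T, hT, rfl⟩, ?_⟩
  rw [Tile.move_move]
  simp [Tile.move_one_zero]

open MeasureTheory in
/-- The Weyl averages of a numbering by distance tend to zero. -/
theorem tendsto_weyl_average_of_isOrderedByDistance (hS : S.IsPrimitive) {X : Set (Tile m)}
    (hX : S.IsSubstitutionTiling X)
    (hinf : ∃ i : Fin m, {α : ℝ | ∃ T ∈ X, T.idx = i ∧ T.orientation = α}.Infinite)
    {p : ℂ} {e : ℕ → Tile m} (he : Enumerates e X) (hp : S.IsOrderedByDistance p e)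
    {n : ℕ} (hn : 0 < n) :
    Tendsto (fun N : ℕ => ‖∑ j ∈ Finset.range N, ((e j).rot : ℂ) ^ n‖ / N) atTop (𝓝 0) := by
  classical
  obtain ⟨heinj, herange⟩ := he
  obtain ⟨ε, hε, hε0, hsum⟩ := S.exists_tendsto_norm_sum_patch_le hS hX hinf hn
  obtain ⟨a, ha0, ha⟩ := S.exists_le_volume_interior_carrier
  obtain ⟨A, hA0, hA⟩ := S.exists_volume_carrier_le
  obtain ⟨D, hD0, hD⟩ := S.exists_dist_carrier_le
  let F : ℕ → Finset (Tile m) := fun N => (Finset.range N).image e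
  -- The distance of the last listed tile: all listed tiles come within `r N` of `p`, and a tile
  -- meeting the open ball must already be listed.
  let r : ℕ → ℝ := fun N => Metric.infDist p ((e (N - 1)).carrier S.proto)
  have hr0 : ∀ N, 0 ≤ r N := fun N => Metric.infDist_nonneg
  have hcard : ∀ N, (F N).card = N := fun N => by
    rw [Finset.card_image_of_injective _ heinj, Finset.card_range]
  have hFX : ∀ N, (F N : Set (Tile m)) ⊆ X := by
    intro N T hT
    obtain ⟨j, -, rfl⟩ := Finset.mem_image.1 (Finset.mem_coe.1 hT)
    exact herange ▸ Set.mem_range_self j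
  have hnear : ∀ N, ∀ T ∈ F N, ∃ z ∈ T.carrier S.proto, dist z p ≤ r N := by
    intro N T hT
    obtain ⟨j, hj, rfl⟩ := Finset.mem_image.1 hT
    have hjN := Finset.mem_range.1 hj
    obtain ⟨z, hz, hzd⟩ := (S.isCompact_carrier (e j)).exists_infDist_eq_dist
      ((S.interior_carrier_nonempty (e j)).mono interior_subset) p
    refine ⟨z, hz, ?_⟩
    rw [dist_comm, ← hzd]
    exact hp (show j ≤ N - 1 by omega)
  have hball : ∀ N, Metric.ball p (r N) ⊆ ⋃ T ∈ F N, T.carrier S.proto := by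
    intro N z hz
    have hzU : z ∈ ⋃ T ∈ X, T.carrier S.proto := by rw [hX.1.1]; trivial
    obtain ⟨T, hT, hzT⟩ := Set.mem_iUnion₂.1 hzU
    rw [← herange] at hT
    obtain ⟨j, rfl⟩ := hT
    refine Set.mem_iUnion₂.2 ⟨e j, Finset.mem_image.2 ⟨j, Finset.mem_range.2 ?_, rfl⟩, hzT⟩
    by_contra! hge
    have h1 : r N ≤ Metric.infDist p ((e j).carrier S.proto) := hp (show N - 1 ≤ j by omega)
    have h2 := Metric.infDist_le_dist_of_mem (x := p) hzT
    rw [dist_comm] at h2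
    exact absurd (Metric.mem_ball.1 hz) (not_lt.2 (h1.trans h2))
  have hupper : ∀ N : ℕ, a * N ≤ Real.pi * (r N + D) ^ 2 := by
    intro N
    have h := S.mul_card_le_volume ha (hX.1.2.subset (hFX N))
      (B := Metric.closedBall p (r N + D)) Metric.isBounded_closedBall (fun T hT z hz => by
        obtain ⟨w, hw, hwr⟩ := hnear N T hT
        have h1 := hD T z hz w hw
        have h2 := dist_triangle z w p
        exact Metric.mem_closedBall.2 (by linarith))
    rwa [hcard, Complex.volume_real_closedBall p (by linarith [hr0 N])] at h
  have hlower : ∀ N : ℕ, Real.pi * r N ^ 2 ≤ A * N := by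
    intro N
    have h := S.volume_le_mul_card hA (hball N)
    rwa [hcard, Complex.volume_real_ball p (hr0 N)] at h
  have hrtop : Tendsto r atTop atTop := by
    refine tendsto_atTop.2 fun C => ?_
    filter_upwards [eventually_gt_atTop ⌈Real.pi * (max C 0 + D) ^ 2 / a⌉₊] with N hN
    by_contra! hlt
    have h1 := (Nat.le_ceil _).trans_lt (Nat.cast_lt (α := ℝ).2 hN)
    rw [div_lt_iff₀ ha0, mul_comm _ a] at h1
    have h2 : (r N + D) ^ 2 ≤ (max C 0 + D) ^ 2 := by
      have := hlt.le.trans (le_max_left C 0)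
      have := hr0 N
      gcongr
    have h3 := mul_le_mul_of_nonneg_left h2 Real.pi_pos.le
    linarith [hupper N]
  rw [Metric.tendsto_nhds]
  intro η hη
  obtain ⟨k, hk⟩ := (hε.eventually (gt_mem_nhds (half_pos hη))).exists
  obtain ⟨B, hB⟩ := S.exists_card_patch_le k
  obtain ⟨c, hc0, hc⟩ := S.exists_norm_sum_le_of_ball k
  -- The order `k` and the constant `c` are fixed before `N`; the ambient order `K` may vary freely.
  -- The last threshold on `r N`, with `π * r N ^ 2 ≤ A * N`, yields `c * r N ≤ η / 2 * N`.
  filter_upwards [eventually_gt_atTop B, hrtop.eventually_ge_atTop c,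
    hrtop.eventually_gt_atTop 0,
    hrtop.eventually_gt_atTop (2 * c * A / (Real.pi * η))] with N hNB hrc hrpos hrη
  obtain ⟨K, T₀, hK⟩ := hX.exists_subset_patch (hFX N)
  have hkK : k ≤ K := by
    by_contra! hlt
    have h1 := hB K hlt T₀
    have h2 := Finset.card_le_card hK
    rw [hcard] at h2
    omega
  have hNpos : (0 : ℝ) < N := Nat.cast_pos.2 (by omega)
  have hmain := hc n K (ε k) T₀ (F N) p (r N) (hε0 k) (hsum k) hkK hK (hball N) (hnear N) hrc
  rw [Finset.sum_image heinj.injOn, hcard] at hmain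
  rw [Real.dist_eq, sub_zero, abs_of_nonneg (by positivity), div_lt_iff₀ hNpos]
  have hpi := Real.pi_pos
  have hcr : c * r N ≤ η / 2 * N := by
    rw [div_lt_iff₀ (by positivity)] at hrη
    have h1 := hlower N
    have h2 : 2 * c * A * r N ≤ r N * (Real.pi * η) * r N :=
      mul_le_mul_of_nonneg_right hrη.le hrpos.le
    have h3 : r N * (Real.pi * η) * r N ≤ η * (A * N) := by
      calc r N * (Real.pi * η) * r N = η * (Real.pi * r N ^ 2) := by ring
        _ ≤ _ := by gcongr
    have h4 : A * (2 * (c * r N)) ≤ A * (η * N) := by linarith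
    linarith [le_of_mul_le_mul_left h4 hA0]
  have h5 : ε k * N < η / 2 * N := mul_lt_mul_of_pos_right hk hNpos
  linarith

end TileSubstitution

end

/-! ### The three statements combined. -/

theorem mainTheorem1 {m : ℕ} (S : TileSubstitution m) (hS : S.IsPrimitive)
    (X : Set (Tile m)) (hX : S.IsSubstitutionTiling X)
    (hinf : ∃ i : Fin m, {α : ℝ | ∃ T ∈ X, T.idx = i ∧ T.orientation = α}.Infinite) :
    (∀ e : ℕ → Tile m, Enumerates e X → S.IsSupertileCompatible e →
      EquidistributedAlong (atTop ⊓ 𝓟 {l : ℕ | S.IsSupertilePrefix e l})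
        (fun j => (e j).orientation)) ∧
    ((∃ e : ℕ → Tile m, Enumerates e X ∧ S.IsSupertileCompatible e) →
      ∃ e : ℕ → Tile m, Enumerates e X ∧ S.IsSupertileCompatible e ∧
        Equidistributed (fun j => (e j).orientation)) ∧
    (∀ (p : ℂ) (e : ℕ → Tile m), Enumerates e X → S.IsOrderedByDistance p e →
      Equidistributed (fun j => (e j).orientation)) := by
  refine ⟨fun e he _ => ?_, ?_, fun p e he hp => ?_⟩
  · exact equidistributedAlong_orientation inf_le_left e fun n hn =>
      S.tendsto_weyl_average_supertilePrefix hS hX hinf he.1 hn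
  · rintro ⟨e, he, hcomp⟩
    obtain ⟨π, hπ, hlim⟩ := exists_perm_weyl_sums (fun j => (e j).rot)
      {l : ℕ | S.IsSupertilePrefix e l} hcomp fun n hn =>
        S.tendsto_weyl_average_supertilePrefix hS hX hinf he.1 hn
    refine ⟨e ∘ π, ⟨he.1.comp π.injective, ?_⟩, fun n => ?_,
      equidistributedAlong_orientation le_rfl (e ∘ π) hlim⟩
    · rw [π.surjective.range_comp, he.2]
    -- At these lengths `π` permutes the initial segment, so the first `l` tiles are the same set as
    -- before.
    · obtain ⟨l, hnl, ⟨k, i, R, t, hk, himg⟩, hl⟩ := hπ n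
      refine ⟨l, hnl, k, i, R, t, hk, ?_⟩
      rw [Set.image_comp, hl, himg]
  · exact equidistributedAlong_orientation le_rfl e fun n hn =>
      S.tendsto_weyl_average_of_isOrderedByDistance hS hX hinf he hp hn
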